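/- Let $T,l>0$ and let $\eta\in H^1(0,T;H^1(0,l))$, identified with its continuous representative on $[0,T]\times[0,l]$, satisfy $\eta\ge 0$. (1) Let $[a,b]\subseteq[0,T]$ and let $f:[a,b]\to(0,l)$ be continuous and monotone (nondecreasing or nonincreasing), with $\{(t,f(t)):t\in[a,b]\}\subseteq\partial\{\eta=0\}$. Then $\partial_t\eta$ vanishes on the graph of $f$ in the following weak sense: for every $\varphi\in L^2(0,T;H^1_0(0,l))$, $$\int_a^b\int_{f(t)}^{l}\partial_{tx}\eta\,\varphi\,dx\,dt=-\int_a^b\int_{f(t)}^{l}\partial_t\eta\,\partial_x\varphi\,dx\,dt$$ and $$\int_a^b\int_0^{f(t)}\partial_{tx}\eta\,\varphi\,dx\,dt=-\int_a^b\int_0^{f(t)}\partial_t\eta\,\partial_x\varphi\,dx\,dt.$$ (2) Assume additionally that $\eta\in W^{1,\infty}(0,T;L^2(0,l))$ and that, for some $v_0\in L^2(0,l)$, $\eta$ satisfies the renormalized momentum inequality: with $u:=\partial_t\eta$ and $u^+:=\max\{u,0\}$, $$\int_0^T\!\!\int_0^l b(u^+)\,\partial_t\varphi\,dx\,dt-\int_0^T\!\!\int_0^l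 \partial_x u\; b'(u^+)\,\partial_x\varphi\,dx\,dt-\int_0^T\!\!\int_0^l|\partial_x u^+|^2\,b''(u^+)\,\varphi\,dx\,dt-\int_0^T\!\!\int_0^l\partial_x\eta\, b'(u^+)\,\partial_x\varphi\,dx\,dt-\int_0^T\!\!\int_0^l\partial_x\eta\,\partial_x\big(b'(u^+)\big)\,\varphi\,dx\,dt\ \ge\ -\int_0^l b(v_0^+)\,\varphi(0,x)\,dx$$ for every non-negative $\varphi\in C_c^\infty([0,T)\times(0,l))$ and every $b\in C^2([0,\infty))$ for which there is a constant $c$ with $b(0)=b'(0)=0$, $b'(x)\le cx$ and $0\le b''(x)\le c$ for all $x\ge0$. Let $0<t_0<t_1<T$ and $0<x_0<x_1<l$ be such that $\eta=0$ on $\{t_1\}\times[x_0,x_1]$ and $\partial_t\eta\le0$ a.e. on $(t_0,t_1)\times(x_0,x_1)$. Then, for every $\phi\in L^2(x_0,x_1)$, $$\lim_{\delta\to0^+}\frac1\delta\int_{t_1}^{t_1+\delta}\int_{x_0}^{x_1}\partial_t\eta(t,x)\,\phi(x)\,dx\,dt=0.$$ -/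

import Mathlib

open Set MeasureTheory Filter Topology
open scoped ContDiff

/-- `ψ ∈ C_c^∞(a, b)`. -/
def IsTestFun (a b : ℝ) (ψ : ℝ → ℝ) : Prop :=
  ContDiff ℝ ∞ ψ ∧ HasCompactSupport ψ ∧ tsupport ψ ⊆ Ioo a b

/-- `g ∈ H¹(0, l)` and `g'` is its weak derivative. -/
structure IsH1 (l : ℝ) (g g' : ℝ → ℝ) : Prop where
  memLp : MemLp g 2 (volume.restrict (Ioo 0 l))
  memLp_deriv : MemLp g' 2 (volume.restrict (Ioo 0 l))
  weakDeriv : ∀ ψ : ℝ → ℝ, IsTestFun 0 l ψ →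
    ∫ x in Ioo 0 l, g x * deriv ψ x = - ∫ x in Ioo 0 l, g' x * ψ x

/-- `g ∈ H¹₀(0, l)`, the closure of `C_c^∞(0, l)` in `H¹(0, l)`, and `g'` is its weak
derivative. -/
structure IsH10 (l : ℝ) (g g' : ℝ → ℝ) : Prop where
  isH1 : IsH1 l g g'
  approx : ∃ ψ : ℕ → ℝ → ℝ, (∀ n, IsTestFun 0 l (ψ n)) ∧
    Tendsto (fun n => eLpNorm (fun x => g x - ψ n x) 2 (volume.restrict (Ioo 0 l)))
      atTop (𝓝 0) ∧
    Tendsto (fun n => eLpNorm (fun x => g' x - deriv (ψ n) x) 2 (volume.restrict (Ioo 0 l)))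
      atTop (𝓝 0)

/-- `v ∈ L²(0, T; H¹(0, l))` and `vx = ∂ₓ v` (weak derivative in space). -/
structure IsL2H1 (T l : ℝ) (v vx : ℝ → ℝ → ℝ) : Prop where
  memLp : MemLp (Function.uncurry v) 2 (volume.restrict (Ioo 0 T ×ˢ Ioo 0 l))
  memLp_deriv : MemLp (Function.uncurry vx) 2 (volume.restrict (Ioo 0 T ×ˢ Ioo 0 l))
  slice : ∀ᵐ t ∂(volume.restrict (Ioo 0 T)), IsH1 l (v t) (vx t)

/-- `v ∈ L²(0, T; H¹₀(0, l))` and `vx = ∂ₓ v` (weak derivative in space). -/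
structure IsL2H10 (T l : ℝ) (v vx : ℝ → ℝ → ℝ) : Prop where
  memLp : MemLp (Function.uncurry v) 2 (volume.restrict (Ioo 0 T ×ˢ Ioo 0 l))
  memLp_deriv : MemLp (Function.uncurry vx) 2 (volume.restrict (Ioo 0 T ×ˢ Ioo 0 l))
  slice : ∀ᵐ t ∂(volume.restrict (Ioo 0 T)), IsH10 l (v t) (vx t)

/-- `η ∈ H¹(0, T; H¹(0, l))`, with `ηx = ∂ₓ η`, `ηt = ∂ₜ η`, `ηtx = ∂ₜₓ η`: both `η` and its weak
time derivative `ηt` (an identity between functions of `x`, for every scalar test function of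
time) lie in `L²(0, T; H¹(0, l))`. -/
structure IsH1H1 (T l : ℝ) (η ηx ηt ηtx : ℝ → ℝ → ℝ) : Prop where
  isL2H1 : IsL2H1 T l η ηx
  isL2H1_deriv : IsL2H1 T l ηt ηtx
  weakDeriv : ∀ θ : ℝ → ℝ, IsTestFun 0 T θ → ∀ᵐ x ∂(volume.restrict (Ioo 0 l)),
    ∫ t in Ioo 0 T, η t x * deriv θ t = - ∫ t in Ioo 0 T, ηt t x * θ t

/-- `v ∈ L^∞(0, T; L²(0, l))`. -/
def IsLinftyL2 (T l : ℝ) (v : ℝ → ℝ → ℝ) : Prop :=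
  AEStronglyMeasurable (Function.uncurry v) (volume.restrict (Ioo 0 T ×ˢ Ioo 0 l)) ∧
  ∃ C : NNReal, ∀ᵐ t ∂(volume.restrict (Ioo 0 T)),
    eLpNorm (v t) 2 (volume.restrict (Ioo 0 l)) ≤ C

/-- `φ ∈ C_c^∞([0, T) × (0, l))`, as the restriction of a smooth function on the plane. -/
def IsSpaceTimeTestFun (T l : ℝ) (φ : ℝ → ℝ → ℝ) : Prop :=
  ContDiff ℝ ∞ (Function.uncurry φ) ∧ HasCompactSupport (Function.uncurry φ) ∧
  tsupport (Function.uncurry φ) ⊆ Iio T ×ˢ Ioo 0 l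

/-- The admissible renormalizations: `b ∈ C²([0, ∞))` with `b(0) = b'(0) = 0`, `b'(x) ≤ c x` and
`0 ≤ b''(x) ≤ c` for some constant `c`. -/
structure IsRenormalizer (b : ℝ → ℝ) : Prop where
  contDiffOn : ContDiffOn ℝ 2 b (Ici 0)
  zero : b 0 = 0
  deriv_zero : derivWithin b (Ici 0) 0 = 0
  growth : ∃ c : ℝ, ∀ x : ℝ, 0 ≤ x → derivWithin b (Ici 0) x ≤ c * x ∧
    0 ≤ iteratedDerivWithin 2 b (Ici 0) x ∧ iteratedDerivWithin 2 b (Ici 0) x ≤ c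

/-- The renormalized momentum inequality on `(0, T) × (0, l)` for the positive part of the velocity
`ηt = ∂ₜ η`, with initial velocity `v₀`. Here `w = ∂ₓ (ηt)⁺` and `z = ∂ₓ (b'((ηt)⁺))` are weak
derivatives; they exist and are unique up to null sets when `ηt ∈ L²(0, T; H¹(0, l))`. -/
def RenormalizedInequality (T l : ℝ) (ηx ηt ηtx : ℝ → ℝ → ℝ) (v₀ : ℝ → ℝ) : Prop :=
  ∀ b : ℝ → ℝ, IsRenormalizer b →
  ∀ φ : ℝ → ℝ → ℝ, IsSpaceTimeTestFun T l φ → (∀ t ∈ Ico 0 T, ∀ x ∈ Ioo 0 l, 0 ≤ φ t x) →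
  ∀ w z : ℝ → ℝ → ℝ,
    IsL2H1 T l (fun t x => max (ηt t x) 0) w →
    IsL2H1 T l (fun t x => derivWithin b (Ici 0) (max (ηt t x) 0)) z →
    (∫ t in (0)..T, ∫ x in (0)..l, b (max (ηt t x) 0) * deriv (fun s => φ s x) t)
      - (∫ t in (0)..T, ∫ x in (0)..l,
          ηtx t x * derivWithin b (Ici 0) (max (ηt t x) 0) * deriv (φ t) x)
      - (∫ t in (0)..T, ∫ x in (0)..l,
          (w t x) ^ 2 * iteratedDerivWithin 2 b (Ici 0) (max (ηt t x) 0) * φ t x)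
      - (∫ t in (0)..T, ∫ x in (0)..l,
          ηx t x * derivWithin b (Ici 0) (max (ηt t x) 0) * deriv (φ t) x)
      - (∫ t in (0)..T, ∫ x in (0)..l, ηx t x * z t x * φ t x)
    ≥ - ∫ x in (0)..l, b (max (v₀ x) 0) * φ 0 x

/-- The contact set `{η = 0}` in `[0, T] × [0, l]`. -/
def contactSet (T l : ℝ) (η : ℝ → ℝ → ℝ) : Set (ℝ × ℝ) :=
  {p | p ∈ Icc 0 T ×ˢ Icc 0 l ∧ η p.1 p.2 = 0}

/-! Write V(t,·) for the continuous representative of `ηt t`, which exists for almost every t.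

Graphs of contact. For every x, η(t,x) − η(s,x) is the integral of V(·,x) from s to t
(`IsH1H1.sub_eq_integral_contRep`). A contact time minimises η(·,x) because η ≥ 0, so wherever the
primitive of V(·,x) is differentiable with derivative V(·,x), contact forces V = 0. The exceptional
null set of times depends on x, and the contact point moves with t. `IsH1H1.ae_contRep_eq_zero`
removes this dependence by enclosing V(·,x) between countably many functions of time indexed by
rational intervals around x. For almost every t the velocity then vanishes at all contact points at
once, and `IsH1.integral_mul_isH10` integrates by parts on each side of f(t) with no boundary term.

Averages after a contact time. Take b(s) = s²/2 and a product test function θ(t)χ(x), where θ is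
switched on while u ≤ 0 and descends with slope −1/δ after t₁. Every integrand contains u⁺ or its
derivative, so nothing before t₁ contributes. The time average of ∫(u⁺)²χ/2 over (t₁, t₁+δ) is then
bounded by a fixed integrable function integrated over (t₁, t₁+2δ), which tends to zero
(`RenormalizedInequality.exists_energy_bound`). Hence averages of u against χ have limsup ≤ 0. They
are also nonnegative, since ∬uχ = ∫η(t₁+δ)χ when η(t₁) = 0 on the support of χ. The same identity
and η ≥ 0 extend the limit to bounded functions dominated by a multiple of χ. Density in L² and the
bound of u in L^∞(0,T;L²) give all φ. -/

/-! ### Test functions and the du Bois-Reymond lemma -/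

theorem exists_isTestFun_eq_one {a b a' b' : ℝ} (hab : a < b) (ha : a < a') (hb : b' < b) :
    ∃ χ : ℝ → ℝ, IsTestFun a b χ ∧ (∀ x, 0 ≤ χ x) ∧ (∀ x, χ x ≤ 1) ∧ ∀ x ∈ Icc a' b', χ x = 1 := by
  obtain ⟨κ, hκ, h1, h2, h3⟩ : ∃ κ : ℝ, 0 < κ ∧ κ ≤ a' - a ∧ κ ≤ b - b' ∧ κ ≤ (b - a) / 2 :=
    ⟨min (min (a' - a) (b - b')) ((b - a) / 2),
      lt_min (lt_min (by linarith) (by linarith)) (by linarith),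
      (min_le_left _ _).trans (min_le_left _ _), (min_le_left _ _).trans (min_le_right _ _),
      min_le_right _ _⟩
  -- The inner ball is [a + κ/2, b − κ/2], which contains [a', b']; the outer one stays κ/4 away
  -- from a and b. The bound κ ≤ (b − a)/2 keeps the inner radius positive, since a' and b' may lie
  -- in any order.
  let f : ContDiffBump ((a + b) / 2) := ⟨(b - a) / 2 - κ / 2, (b - a) / 2 - κ / 4, by linarith,
    by linarith⟩
  refine ⟨f, ⟨f.contDiff, f.hasCompactSupport, ?_⟩, fun x => f.nonneg, fun x => f.le_one, ?_⟩
  · rw [f.tsupport_eq, Real.closedBall_eq_Icc]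
    intro x hx
    simp only [f, mem_Icc, mem_Ioo] at hx ⊢
    constructor <;> linarith
  · intro x hx
    apply f.one_of_mem_closedBall
    rw [Real.closedBall_eq_Icc]
    simp only [f, mem_Icc] at hx ⊢
    constructor <;> linarith

theorem IsTestFun.eq_zero {a b : ℝ} {ψ : ℝ → ℝ} (h : IsTestFun a b ψ) {x : ℝ}
    (hx : x ∉ Ioo a b) : ψ x = 0 :=
  image_eq_zero_of_notMem_tsupport fun h' => hx (h.2.2 h')

theorem IsTestFun.exists_Icc {a b : ℝ} (hab : a < b) {ψ : ℝ → ℝ} (h : IsTestFun a b ψ) :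
    ∃ p q, a < p ∧ p ≤ q ∧ q < b ∧ ∀ x, x ∉ Icc p q → ψ x = 0 := by
  -- The midpoint keeps the compact set nonempty when ψ = 0.
  have hK : IsCompact (insert ((a + b) / 2) (tsupport ψ)) := h.2.1.isCompact.insert _
  have hne : (insert ((a + b) / 2) (tsupport ψ)).Nonempty := insert_nonempty _ _
  have hsub : insert ((a + b) / 2) (tsupport ψ) ⊆ Ioo a b :=
    insert_subset ⟨by linarith, by linarith⟩ h.2.2
  refine ⟨_, _, (hsub (hK.sInf_mem hne)).1, ?_, (hsub (hK.sSup_mem hne)).2, fun x hx => ?_⟩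
  · exact csInf_le hK.bddBelow (hK.sSup_mem hne)
  · by_contra hne'
    have : x ∈ insert ((a + b) / 2) (tsupport ψ) :=
      mem_insert_of_mem _ (subset_tsupport _ hne')
    exact hx ⟨csInf_le hK.bddBelow this, le_csSup hK.bddAbove this⟩

theorem IsTestFun.of_Icc {a b p q : ℝ} {ψ : ℝ → ℝ} (hψ : ContDiff ℝ ∞ ψ) (ha : a < p) (hb : q < b)
    (h : ∀ x, x ∉ Icc p q → ψ x = 0) : IsTestFun a b ψ := by
  refine ⟨hψ, HasCompactSupport.intro isCompact_Icc h, ?_⟩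
  have : tsupport ψ ⊆ Icc p q :=
    closure_minimal (fun x hx => by by_contra h'; exact hx (h x h')) isClosed_Icc
  exact this.trans fun x hx => ⟨ha.trans_le hx.1, hx.2.trans_lt hb⟩

/-- A smooth function has a smooth primitive. -/
theorem contDiff_infty_primitive {ψ : ℝ → ℝ} (hψ : ContDiff ℝ ∞ ψ) (a : ℝ) :
    ContDiff ℝ ∞ (fun x => ∫ y in a..x, ψ y) ∧ deriv (fun x => ∫ y in a..x, ψ y) = ψ := by
  have hd : ∀ x, HasDerivAt (fun x => ∫ y in a..x, ψ y) (ψ x) x := fun x =>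
    intervalIntegral.integral_hasDerivAt_right (hψ.continuous.intervalIntegrable _ _)
      (hψ.continuous.stronglyMeasurableAtFilter _ _) hψ.continuous.continuousAt
  have hde : deriv (fun x => ∫ y in a..x, ψ y) = ψ := funext fun x => (hd x).deriv
  refine ⟨?_, hde⟩
  rw [contDiff_infty_iff_deriv, hde]
  exact ⟨fun x => (hd x).differentiableAt, hψ⟩

theorem setIntegral_Ioo_eq {a b : ℝ} (hab : a ≤ b) (F : ℝ → ℝ) :
    ∫ x in Ioo a b, F x = ∫ x in a..b, F x := by
  rw [intervalIntegral.integral_of_le hab, integral_Ioc_eq_integral_Ioo]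

/-- Zero mean makes the primitive started at 0 vanish to the right of the support as well, so it has
compact support again. -/
theorem IsTestFun.exists_primitive {l : ℝ} (hl : 0 < l) {ψ : ℝ → ℝ} (h : IsTestFun 0 l ψ)
    (h0 : ∫ x in (0)..l, ψ x = 0) : ∃ Ψ, IsTestFun 0 l Ψ ∧ deriv Ψ = ψ := by
  obtain ⟨p, q, hp, hpq, hq, hz⟩ := h.exists_Icc hl
  refine ⟨_, ?_, (contDiff_infty_primitive h.1 0).2⟩
  refine IsTestFun.of_Icc (contDiff_infty_primitive h.1 0).1 hp hq fun x hx => ?_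
  have hii : ∀ a b, IntervalIntegrable ψ volume a b := h.1.continuous.intervalIntegrable
  have hc : x < p ∨ q < x := by
    by_contra hcon; push Not at hcon; exact hx hcon
  rcases hc with hc | hc
  · rw [intervalIntegral.integral_congr (g := fun _ => 0)]
    · simp
    · intro y hy
      apply hz
      intro hy'
      rcases le_total 0 x with h0x | h0x
      · rw [uIcc_of_le h0x] at hy; linarith [hy.2, hy'.1]
      · rw [uIcc_of_ge h0x] at hy; linarith [hy.2, hy'.1]
  · rw [← intervalIntegral.integral_add_adjacent_intervals (hii 0 l) (hii l x), h0, zero_add,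
      intervalIntegral.integral_congr (g := fun _ => 0)]
    · simp
    · intro y hy
      apply hz
      intro hy'
      rcases le_total l x with h0x | h0x
      · rw [uIcc_of_le h0x] at hy; linarith [hy.1, hy'.2]
      · rw [uIcc_of_ge h0x] at hy; linarith [hy.1, hy'.2]

theorem integrable_mul_of_continuous {l : ℝ} {h ψ : ℝ → ℝ}
    (hh : IntegrableOn h (Ioo 0 l)) (hψ : Continuous ψ) :
    IntegrableOn (fun x => h x * ψ x) (Ioo 0 l) := by
  obtain ⟨C, hC⟩ := (isCompact_Icc (a := (0 : ℝ)) (b := l)).exists_bound_of_continuousOn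
    hψ.continuousOn
  refine Integrable.mul_bdd (c := C) hh hψ.aestronglyMeasurable ?_
  filter_upwards [ae_restrict_mem measurableSet_Ioo] with x hx
  exact hC x ⟨hx.1.le, hx.2.le⟩

/-- The du Bois-Reymond lemma. -/
theorem ae_eq_const_of_integral_mul_deriv_eq_zero {l : ℝ} (hl : 0 < l) {h : ℝ → ℝ}
    (hh : IntegrableOn h (Ioo 0 l))
    (H : ∀ ψ, IsTestFun 0 l ψ → ∫ x in Ioo 0 l, h x * deriv ψ x = 0) :
    ∃ c, ∀ᵐ x ∂(volume.restrict (Ioo 0 l)), h x = c := by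
  obtain ⟨χ, hχ, hχ0, -, hχ1⟩ := exists_isTestFun_eq_one (a' := l / 3) (b' := 2 * l / 3) hl
    (by linarith) (by linarith)
  have hpos : 0 < ∫ x in (0)..l, χ x := by
    have hii : ∀ a b, IntervalIntegrable χ volume a b := hχ.1.continuous.intervalIntegrable
    rw [← intervalIntegral.integral_add_adjacent_intervals (hii 0 (l / 3)) (hii _ _),
      ← intervalIntegral.integral_add_adjacent_intervals (hii (l / 3) (2 * l / 3)) (hii _ _)]
    have h1 : ∫ x in (l / 3)..(2 * l / 3), χ x = l / 3 := by
      rw [intervalIntegral.integral_congr (g := fun _ => 1)]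
      · simp; ring
      · intro x hx; rw [uIcc_of_le (by linarith)] at hx; exact hχ1 x hx
    have h2 : 0 ≤ ∫ x in (0)..(l / 3), χ x :=
      intervalIntegral.integral_nonneg (by linarith) fun x _ => hχ0 x
    have h3 : 0 ≤ ∫ x in (2 * l / 3)..l, χ x :=
      intervalIntegral.integral_nonneg (by linarith) fun x _ => hχ0 x
    linarith
  set m := ∫ x in (0)..l, χ x with hm
  set c := (∫ x in Ioo 0 l, h x * χ x) / m with hc
  refine ⟨c, ?_⟩
  have hhc : IntegrableOn (fun x => h x - c) (Ioo 0 l) volume :=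
    Integrable.sub (μ := volume.restrict (Ioo 0 l)) hh (integrable_const c)
  have hloc : LocallyIntegrableOn (fun x => h x - c) (Ioo 0 l) :=
    hhc.locallyIntegrableOn
  have := isOpen_Ioo.ae_eq_zero_of_integral_contDiff_smul_eq_zero hloc ?_
  · rw [ae_restrict_iff' measurableSet_Ioo]
    filter_upwards [this] with x hx hx'
    linarith [hx hx']
  intro ψ hψ hψc hψs
  have hψt : IsTestFun 0 l ψ := ⟨hψ, hψc, hψs⟩
  set k := (∫ x in (0)..l, ψ x) / m with hk
  have hmk : m * k = ∫ x in (0)..l, ψ x := by rw [hk]; field_simp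
  -- Removing the multiple of χ with the same mean leaves the derivative of a test function, which h
  -- annihilates. Hence ∫hψ = k∫hχ = c∫ψ.
  have ht : IsTestFun 0 l (fun x => ψ x - k * χ x) := by
    obtain ⟨p, q, hp, hpq, hq, hz⟩ := hψt.exists_Icc hl
    obtain ⟨p', q', hp', hpq', hq', hz'⟩ := hχ.exists_Icc hl
    refine IsTestFun.of_Icc (p := min p p') (q := max q q') (hψ.sub (contDiff_const.mul hχ.1))
      (lt_min hp hp') (max_lt hq hq') fun x hx => ?_
    rw [hz x, hz' x]
    · simp
    · exact fun h => hx ⟨(min_le_right _ _).trans h.1, h.2.trans (le_max_right _ _)⟩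
    · exact fun h => hx ⟨(min_le_left _ _).trans h.1, h.2.trans (le_max_left _ _)⟩
  obtain ⟨Ψ, hΨ, hΨd⟩ := ht.exists_primitive hl (by
    rw [intervalIntegral.integral_sub (hψ.continuous.intervalIntegrable _ _)
      ((hχ.1.continuous.const_mul k).intervalIntegrable _ _),
      intervalIntegral.integral_const_mul, ← hmk]
    ring)
  have h1 := H Ψ hΨ
  rw [hΨd] at h1
  have hi1 := integrable_mul_of_continuous hh hψ.continuous
  have hi2 := integrable_mul_of_continuous hh hχ.1.continuous
  have h2 : ∫ x in Ioo 0 l, h x * (ψ x - k * χ x)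
      = (∫ x in Ioo 0 l, h x * ψ x) - k * ∫ x in Ioo 0 l, h x * χ x := by
    rw [← integral_const_mul, ← integral_sub hi1 (hi2.const_mul k)]
    congr 1; ext x; ring
  have hψi : IntegrableOn ψ (Ioo 0 l) := (hψ.continuous.integrable_of_hasCompactSupport hψc).integrableOn
  have h3 : ∫ x, ψ x • (h x - c) = ∫ x in Ioo 0 l, ψ x • (h x - c) := by
    symm
    apply setIntegral_eq_integral_of_forall_compl_eq_zero
    intro x hx; rw [hψt.eq_zero hx]; simp
  have h4 : ∫ x in Ioo 0 l, ψ x • (h x - c)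
      = (∫ x in Ioo 0 l, h x * ψ x) - c * ∫ x in Ioo 0 l, ψ x := by
    rw [← integral_const_mul, ← integral_sub hi1 (hψi.const_mul c)]
    congr 1; ext x; simp; ring
  rw [h3, h4, setIntegral_Ioo_eq hl.le ψ, ← hmk]
  rw [h2] at h1
  have : c * m = ∫ x in Ioo 0 l, h x * χ x := by rw [hc]; field_simp
  rw [← this] at h1
  linarith

/-! ### Continuous representatives on (0, l) and the positive part -/

/-- The value at `0` of the continuous representative of `g ∈ H¹(0, l)`. -/
noncomputable def boundaryValue (l : ℝ) (g g' : ℝ → ℝ) : ℝ :=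
  1 / l * ∫ y in Ioo 0 l, (g y - g' y * (l - y))

/-- The continuous representative of `g ∈ H¹(0, l)`. -/
noncomputable def contRep (l : ℝ) (g g' : ℝ → ℝ) (x : ℝ) : ℝ :=
  boundaryValue l g g' + ∫ z in (0)..x, g' z

theorem MeasureTheory.MemLp.integrableOn_Ioo {l : ℝ} {g : ℝ → ℝ}
    (h : MemLp g 2 (volume.restrict (Ioo 0 l))) : IntegrableOn g (Ioo 0 l) :=
  h.integrable (by norm_num)

theorem intervalIntegrable_of_integrableOn_Ioo {l : ℝ} {g : ℝ → ℝ} (h : IntegrableOn g (Ioo 0 l))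
    {c d : ℝ} (hc : c ∈ Icc 0 l) (hd : d ∈ Icc 0 l) : IntervalIntegrable g volume c d := by
  rw [intervalIntegrable_iff]
  refine ((integrableOn_Icc_iff_integrableOn_Ioo (μ := volume)).2 h).mono_set ?_
  exact uIoc_subset_uIcc.trans (uIcc_subset_Icc hc hd)

theorem absolutelyContinuousOnInterval_contRep {l : ℝ} (hl : 0 < l) (g : ℝ → ℝ) {g' : ℝ → ℝ}
    (h : IntegrableOn g' (Ioo 0 l)) :
    AbsolutelyContinuousOnInterval (contRep l g g') 0 l := by
  have h1 : AbsolutelyContinuousOnInterval (fun _ : ℝ => boundaryValue l g g') 0 l :=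
    (LipschitzWith.const _).lipschitzOnWith.absolutelyContinuousOnInterval
  exact h1.add ((intervalIntegrable_of_integrableOn_Ioo h (left_mem_Icc.2 hl.le)
    (right_mem_Icc.2 hl.le)).absolutelyContinuousOnInterval_intervalIntegral
      (left_mem_uIcc))

theorem ae_hasDerivAt_contRep {l : ℝ} (hl : 0 < l) (g : ℝ → ℝ) {g' : ℝ → ℝ}
    (h : IntegrableOn g' (Ioo 0 l)) :
    ∀ᵐ x, x ∈ Icc 0 l → HasDerivAt (contRep l g g') (g' x) x := by
  have := (intervalIntegrable_of_integrableOn_Ioo h (left_mem_Icc.2 hl.le)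
    (right_mem_Icc.2 hl.le)).ae_hasDerivAt_integral
  filter_upwards [this] with x hx hx'
  rw [uIcc_of_le hl.le] at hx
  exact (hx hx' 0 (left_mem_Icc.2 hl.le)).const_add _

theorem IsTestFun.absolutelyContinuousOnInterval {a b c d : ℝ} {ψ : ℝ → ℝ} (h : IsTestFun a b ψ) :
    AbsolutelyContinuousOnInterval ψ c d :=
  (h.1.of_le (by simp)).contDiffOn.absolutelyContinuousOnInterval

/-- Integration by parts for an absolutely continuous function with almost everywhere derivative
`g'`. -/
theorem AbsolutelyContinuousOnInterval.integral_mul_deriv_testFun {a b c d : ℝ} {G g' ψ : ℝ → ℝ}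
    (hG : AbsolutelyContinuousOnInterval G c d)
    (hd : ∀ᵐ x, x ∈ uIcc c d → HasDerivAt G (g' x) x) (h : IsTestFun a b ψ) :
    ∫ x in c..d, G x * deriv ψ x = G d * ψ d - G c * ψ c - ∫ x in c..d, g' x * ψ x := by
  rw [hG.integral_mul_deriv_eq_deriv_mul h.absolutelyContinuousOnInterval]
  congr 1
  apply intervalIntegral.integral_congr_ae
  filter_upwards [hd] with x hx hx'
  rw [(hx (uIoc_subset_uIcc hx')).deriv]

theorem IsTestFun.deriv_continuous {a b : ℝ} {ψ : ℝ → ℝ} (h : IsTestFun a b ψ) :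
    Continuous (deriv ψ) := h.1.continuous_deriv (by simp)

theorem integrableOn_of_absolutelyContinuousOnInterval {l : ℝ} (hl : 0 < l) {G : ℝ → ℝ}
    (hG : AbsolutelyContinuousOnInterval G 0 l) : IntegrableOn G (Ioo 0 l) := by
  have := hG.continuousOn
  rw [uIcc_of_le hl.le] at this
  exact (this.integrableOn_compact isCompact_Icc).mono_set Ioo_subset_Icc_self

/-- A function with an integrable weak derivative agrees almost everywhere with its continuous
representative. -/
theorem ae_eq_contRep {l : ℝ} (hl : 0 < l) {g g' : ℝ → ℝ} (hg : IntegrableOn g (Ioo 0 l))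
    (hg' : IntegrableOn g' (Ioo 0 l))
    (H : ∀ ψ, IsTestFun 0 l ψ → ∫ x in Ioo 0 l, g x * deriv ψ x = -∫ x in Ioo 0 l, g' x * ψ x) :
    ∀ᵐ x ∂(volume.restrict (Ioo 0 l)), g x = contRep l g g' x := by
  have hAC := absolutelyContinuousOnInterval_contRep hl g hg'
  have hGi := integrableOn_of_absolutelyContinuousOnInterval hl hAC
  obtain ⟨c, hc⟩ := ae_eq_const_of_integral_mul_deriv_eq_zero hl
      (h := fun x => g x - contRep l g g' x)
      (Integrable.sub (μ := volume.restrict (Ioo 0 l)) hg hGi) fun ψ hψ => by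
    have h1 := integrable_mul_of_continuous hg hψ.deriv_continuous
    have h2 := integrable_mul_of_continuous hGi hψ.deriv_continuous
    simp_rw [sub_mul]
    rw [integral_sub h1 h2, H ψ hψ, setIntegral_Ioo_eq hl.le (fun x => contRep l g g' x * _),
      hAC.integral_mul_deriv_testFun (g' := g') (by
        rw [uIcc_of_le hl.le]; exact ae_hasDerivAt_contRep hl g hg') hψ, hψ.eq_zero (x := l) (by simp),
      hψ.eq_zero (x := 0) (by simp), setIntegral_Ioo_eq hl.le]
    ring
  -- It remains to see that the constant is zero. Integrating `contRep` by parts against l − y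
  -- recovers l · `boundaryValue`; the same formula applied to g = c + `contRep` gives an extra c ·
  -- l, so c = 0.
  have hlin : AbsolutelyContinuousOnInterval (fun y => l - y) 0 l :=
    (contDiff_const.sub contDiff_id : ContDiff ℝ 1 fun y : ℝ => l - y).contDiffOn
      |>.absolutelyContinuousOnInterval
  have hparts := hAC.integral_mul_deriv_eq_deriv_mul hlin
  have hd : ∫ y in (0)..l, deriv (contRep l g g') y * (l - y) = ∫ y in (0)..l, g' y * (l - y) := by
    apply intervalIntegral.integral_congr_ae
    filter_upwards [ae_hasDerivAt_contRep hl g hg'] with x hx hx'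
    rw [(hx (by rw [← uIcc_of_le hl.le]; exact uIoc_subset_uIcc hx')).deriv]
  have hb : l * boundaryValue l g g' = c * l + l * boundaryValue l g g' := by
    have e : ∀ᵐ y ∂(volume.restrict (Ioo 0 l)),
        g y - g' y * (l - y) = (c + contRep l g g' y) - g' y * (l - y) := by
      filter_upwards [hc] with y hy
      rw [← hy]; ring
    conv_lhs => rw [boundaryValue, integral_congr_ae e]
    have hcG : Integrable (fun y => c + contRep l g g' y) (volume.restrict (Ioo 0 l)) :=
      (integrable_const c).add hGi
    rw [integral_sub hcG (integrable_mul_of_continuous hg' (ψ := fun y => l - y) (by fun_prop)), integral_add (integrable_const c) hGi,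
      setIntegral_Ioo_eq hl.le, setIntegral_Ioo_eq hl.le, setIntegral_Ioo_eq hl.le, ← hd]
    have h0 : contRep l g g' 0 = boundaryValue l g g' := by simp [contRep]
    rw [h0] at hparts
    have hder : deriv (fun y => l - y) = fun _ => (-1 : ℝ) :=
      funext fun y => ((hasDerivAt_id y).const_sub l).deriv
    simp only [hder, mul_neg, mul_one, sub_self, mul_zero, sub_zero, zero_sub,
      intervalIntegral.integral_neg] at hparts
    rw [intervalIntegral.integral_const, smul_eq_mul]
    field_simp
    linarith
  have hc0 : c = 0 := by
    have : c * l = 0 := by linarith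
    exact (mul_eq_zero.1 this).resolve_right hl.ne'
  filter_upwards [hc] with x hx
  linarith

theorem IsH1.ae_eq_contRep {l : ℝ} (hl : 0 < l) {g g' : ℝ → ℝ} (h : IsH1 l g g') :
    ∀ᵐ x ∂(volume.restrict (Ioo 0 l)), g x = contRep l g g' x :=
  _root_.ae_eq_contRep hl h.memLp.integrableOn_Ioo h.memLp_deriv.integrableOn_Ioo h.weakDeriv

theorem continuousOn_contRep {l : ℝ} (hl : 0 < l) (g : ℝ → ℝ) {g' : ℝ → ℝ}
    (h : IntegrableOn g' (Ioo 0 l)) : ContinuousOn (contRep l g g') (Icc 0 l) := by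
  have := (absolutelyContinuousOnInterval_contRep hl g h).continuousOn
  rwa [uIcc_of_le hl.le] at this

/-- The positive part of an `H¹` function is in `H¹`. -/
theorem IsH1.posPart {l : ℝ} (hl : 0 < l) {g g' : ℝ → ℝ} (h : IsH1 l g g') :
    IsH1 l (fun x => max (g x) 0) ({x | 0 < g x}.indicator g') := by
  set G := contRep l g g' with hGdef
  have hae := h.ae_eq_contRep hl
  have hi' := h.memLp_deriv.integrableOn_Ioo
  have hms : NullMeasurableSet {x | 0 < g x} (volume.restrict (Ioo 0 l)) :=
    nullMeasurableSet_lt aemeasurable_const h.memLp.aestronglyMeasurable.aemeasurable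
  refine ⟨?_, ?_, fun ψ hψ => ?_⟩
  · refine h.memLp.mono ?_ ?_
    · exact (h.memLp.aestronglyMeasurable.aemeasurable.max aemeasurable_const).aestronglyMeasurable
    · refine Eventually.of_forall fun x => ?_
      simp only [Real.norm_eq_abs]
      rcases le_total (g x) 0 with h0 | h0 <;> simp [h0]
  · refine h.memLp_deriv.mono (h.memLp_deriv.aestronglyMeasurable.indicator₀ hms) ?_
    exact Eventually.of_forall fun x => norm_indicator_le_norm_self _ _
  have hAC := absolutelyContinuousOnInterval_contRep hl g hi'
  have hACp : AbsolutelyContinuousOnInterval (fun x => max (G x) 0) 0 l := by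
    have hab : AbsolutelyContinuousOnInterval (fun x => |G x|) 0 l := by
      have hAC' := hAC
      rw [absolutelyContinuousOnInterval_iff] at hAC' ⊢
      intro ε hε
      obtain ⟨δ, hδ, H⟩ := hAC' ε hε
      refine ⟨δ, hδ, fun E hE hE' => lt_of_le_of_lt ?_ (H E hE hE')⟩
      refine Finset.sum_le_sum fun i _ => ?_
      simp only [Real.dist_eq]
      exact abs_abs_sub_abs_le_abs_sub _ _
    have := (hAC.add hab).const_mul (1 / 2)
    convert this using 2 with x
    simp only [Pi.add_apply, ← hGdef]
    rcases le_total (G x) 0 with h0 | h0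
    · rw [max_eq_right h0, abs_of_nonpos h0]; ring
    · rw [max_eq_left h0, abs_of_nonneg h0]; ring
  have hder : ∀ᵐ x, x ∈ uIcc 0 l → HasDerivAt (fun x => max (G x) 0)
      ({x | 0 < G x}.indicator g' x) x := by
    filter_upwards [ae_hasDerivAt_contRep hl g hi', hACp.ae_differentiableAt] with x hx hx2 hxm
    have hd := hx (by rwa [uIcc_of_le hl.le] at hxm)
    rcases lt_trichotomy (G x) 0 with h0 | h0 | h0
    · rw [indicator_of_notMem (by simp [h0.le])]
      refine (hasDerivAt_const x (0 : ℝ)).congr_of_eventuallyEq ?_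
      filter_upwards [hd.continuousAt.eventually_lt_const h0] with y hy
      exact max_eq_right hy.le
    -- At a zero of G the positive part attains its minimum, so its derivative there, which exists
    -- almost everywhere, must be 0 whatever g' is.
    · rw [indicator_of_notMem (by simp [h0])]
      have hd2 := (hx2 hxm).hasDerivAt
      have hmin : IsLocalMin (fun x => max (G x) 0) x :=
        Eventually.of_forall fun y => by simp [h0]
      rwa [hmin.deriv_eq_zero] at hd2
    · rw [indicator_of_mem (by exact h0)]
      refine hd.congr_of_eventuallyEq ?_
      filter_upwards [hd.continuousAt.eventually_const_lt h0] with y hy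
      exact max_eq_left hy.le
  have key := hACp.integral_mul_deriv_testFun hder hψ
  rw [hψ.eq_zero (x := l) (by simp), hψ.eq_zero (x := 0) (by simp), ← setIntegral_Ioo_eq hl.le,
    ← setIntegral_Ioo_eq hl.le] at key
  have e1 : ∫ x in Ioo 0 l, max (g x) 0 * deriv ψ x = ∫ x in Ioo 0 l, max (G x) 0 * deriv ψ x := by
    apply integral_congr_ae
    filter_upwards [hae] with x hx
    rw [hx]
  have e2 : ∫ x in Ioo 0 l, {x | 0 < g x}.indicator g' x * ψ x
      = ∫ x in Ioo 0 l, {x | 0 < G x}.indicator g' x * ψ x := by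
    apply integral_congr_ae
    filter_upwards [hae] with x hx
    simp only [indicator, mem_ofPred_eq, hx, hGdef]
  rw [e1, e2, key]
  ring

/-! ### Integration by parts against H¹₀ functions -/

theorem tendsto_integral_mul_of_tendsto_eLpNorm {μ : Measure ℝ} {v u : ℝ → ℝ} {U : ℕ → ℝ → ℝ}
    (hv : MemLp v 2 μ) (hu : MemLp u 2 μ) (hU : ∀ n, MemLp (U n) 2 μ)
    (h : Tendsto (fun n => eLpNorm (fun x => u x - U n x) 2 μ) atTop (𝓝 0)) :
    Tendsto (fun n => ∫ x, v x * U n x ∂μ) atTop (𝓝 (∫ x, v x * u x ∂μ)) := by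
  apply tendsto_integral_of_L1 _ (hv.integrable_mul hu).aestronglyMeasurable
    (Eventually.of_forall fun n => hv.integrable_mul (hU n))
  have hb : ∀ n, ∫⁻ x, ‖v x * U n x - v x * u x‖ₑ ∂μ
      ≤ eLpNorm v 2 μ * eLpNorm (fun x => u x - U n x) 2 μ := by
    intro n
    have h1 : ∫⁻ x, ‖v x * U n x - v x * u x‖ₑ ∂μ
        = eLpNorm (v • fun x => u x - U n x) 1 μ := by
      rw [eLpNorm_one_eq_lintegral_enorm]
      apply lintegral_congr
      intro x
      rw [← enorm_neg]
      congr 1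
      simp only [Pi.smul_apply', smul_eq_mul]
      ring
    rw [h1]
    exact eLpNorm_smul_le_mul_eLpNorm (hu.sub (hU n)).aestronglyMeasurable hv.aestronglyMeasurable
  have hlim : Tendsto (fun n => eLpNorm v 2 μ * eLpNorm (fun x => u x - U n x) 2 μ) atTop
      (𝓝 0) := by
    have := ENNReal.Tendsto.const_mul (a := eLpNorm v 2 μ) h (Or.inr hv.eLpNorm_ne_top)
    simpa using this
  exact tendsto_of_tendsto_of_tendsto_of_le_of_le tendsto_const_nhds hlim (fun _ => zero_le) hb

theorem Continuous.memLp_two_Ioo {ψ : ℝ → ℝ} (h : Continuous ψ) (a b : ℝ) :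
    MemLp ψ 2 (volume.restrict (Ioo a b)) := by
  obtain ⟨C, hC⟩ := (isCompact_Icc (a := a) (b := b)).exists_bound_of_continuousOn h.continuousOn
  refine MemLp.of_bound h.aestronglyMeasurable C ?_
  filter_upwards [ae_restrict_mem measurableSet_Ioo] with x hx
  exact hC x (Ioo_subset_Icc_self hx)

/-- Integration by parts on a subinterval for `g ∈ H¹` and `φ ∈ H¹₀`, when the boundary terms
vanish. -/
theorem IsH1.integral_mul_isH10 {l : ℝ} (hl : 0 < l) {g g' φ φ' : ℝ → ℝ} (h : IsH1 l g g')
    (hφ : IsH10 l φ φ') {c d : ℝ} (hc : c ∈ Icc 0 l) (hd : d ∈ Icc 0 l) (hcd : c ≤ d)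
    (hc0 : c = 0 ∨ contRep l g g' c = 0) (hd0 : d = l ∨ contRep l g g' d = 0) :
    ∫ x in c..d, g' x * φ x = -∫ x in c..d, g x * φ' x := by
  obtain ⟨ψ, hψ, hlim, hlim'⟩ := hφ.approx
  have hi' := h.memLp_deriv.integrableOn_Ioo
  have hsub : Ioo c d ⊆ Ioo 0 l := Ioo_subset_Ioo hc.1 hd.2
  have hle : volume.restrict (Ioo c d) ≤ volume.restrict (Ioo 0 l) :=
    Measure.restrict_mono hsub le_rfl
  have mono : ∀ U : ℕ → ℝ → ℝ,
      Tendsto (fun n => eLpNorm (U n) 2 (volume.restrict (Ioo 0 l))) atTop (𝓝 0) →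
      Tendsto (fun n => eLpNorm (U n) 2 (volume.restrict (Ioo c d))) atTop (𝓝 0) := fun U hU =>
    tendsto_of_tendsto_of_tendsto_of_le_of_le tendsto_const_nhds hU (fun _ => zero_le)
      fun n => eLpNorm_mono_measure _ hle
  have t1 := tendsto_integral_mul_of_tendsto_eLpNorm (h.memLp_deriv.mono_measure hle)
    (hφ.isH1.memLp.mono_measure hle) (fun n => (hψ n).1.continuous.memLp_two_Ioo c d)
    (mono _ hlim)
  have t2 := tendsto_integral_mul_of_tendsto_eLpNorm (h.memLp.mono_measure hle)
    (hφ.isH1.memLp_deriv.mono_measure hle)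
    (fun n => (hψ n).deriv_continuous.memLp_two_Ioo c d) (mono _ hlim')
  simp_rw [setIntegral_Ioo_eq hcd] at t1 t2
  -- Both sides are limits along ψ n, so the identity is needed only for test functions. Each
  -- boundary term then vanishes through ψ n at 0 or l, or through `contRep` at a contact point.
  refine tendsto_nhds_unique t1 (t2.neg.congr fun n => ?_)
  have e : ∫ x in c..d, g x * deriv (ψ n) x = ∫ x in c..d, contRep l g g' x * deriv (ψ n) x := by
    rw [← setIntegral_Ioo_eq hcd, ← setIntegral_Ioo_eq hcd]
    apply integral_congr_ae
    filter_upwards [ae_mono hle (h.ae_eq_contRep hl)] with x hx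
    rw [hx]
  have hsub' : uIcc c d ⊆ uIcc 0 l := by
    rw [uIcc_of_le hl.le]; exact uIcc_subset_Icc hc hd
  rw [e, ((absolutelyContinuousOnInterval_contRep hl g hi').mono
    hsub').integral_mul_deriv_testFun (g' := g') (by
      filter_upwards [ae_hasDerivAt_contRep hl g hi'] with x hx hx'
      exact hx (by rw [← uIcc_of_le hl.le]; exact hsub' hx')) (hψ n)]
  have z1 : contRep l g g' c * ψ n c = 0 := by
    rcases hc0 with rfl | h0
    · rw [(hψ n).eq_zero (by simp)]; simp
    · rw [h0]; simp
  have z2 : contRep l g g' d * ψ n d = 0 := by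
    rcases hd0 with rfl | h0
    · rw [(hψ n).eq_zero (by simp)]; simp
    · rw [h0]; simp
  rw [z1, z2]
  ring

/-! ### Increments in time of η -/

theorem volume_restrict_prod (s t : Set ℝ) :
    (volume : Measure (ℝ × ℝ)).restrict (s ×ˢ t)
      = (volume.restrict s).prod (volume.restrict t) := by
  rw [Measure.volume_eq_prod, Measure.prod_restrict]

theorem MeasureTheory.MemLp.integrable_prod {T l : ℝ} {v : ℝ → ℝ → ℝ}
    (h : MemLp (Function.uncurry v) 2 (volume.restrict (Ioo 0 T ×ˢ Ioo 0 l))) :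
    Integrable (Function.uncurry v) ((volume.restrict (Ioo 0 T)).prod (volume.restrict (Ioo 0 l))) := by
  rw [volume_restrict_prod] at h
  exact h.integrable (by norm_num)

theorem MeasureTheory.Integrable.mono_Ioo {T l : ℝ} {v : ℝ × ℝ → ℝ}
    (h : Integrable v ((volume.restrict (Ioo 0 T)).prod (volume.restrict (Ioo 0 l))))
    {s t p q : ℝ} (hs : 0 ≤ s) (ht : t ≤ T) (hp : 0 ≤ p) (hq : q ≤ l) :
    Integrable v ((volume.restrict (Ioo s t)).prod (volume.restrict (Ioo p q))) := by
  rw [← volume_restrict_prod] at h ⊢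
  exact h.mono_measure
    (Measure.restrict_mono (prod_mono (Ioo_subset_Ioo hs ht) (Ioo_subset_Ioo hp hq)) le_rfl)

theorem MeasureTheory.Integrable.mul_snd {μ ν : Measure ℝ} [SFinite μ] [SFinite ν] {v : ℝ → ℝ → ℝ}
    (h : Integrable (Function.uncurry v) (μ.prod ν)) {ζ : ℝ → ℝ} (hζ : AEStronglyMeasurable ζ ν)
    {C : ℝ} (hC : ∀ᵐ x ∂ν, |ζ x| ≤ C) :
    Integrable (Function.uncurry fun t x => v t x * ζ x) (μ.prod ν) :=
  Integrable.mul_bdd (c := C) h hζ.comp_snd (Measure.quasiMeasurePreserving_snd.ae hC)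

theorem MeasureTheory.Integrable.mul_fst {μ ν : Measure ℝ} [SFinite μ] [SFinite ν] {v : ℝ → ℝ → ℝ}
    (h : Integrable (Function.uncurry v) (μ.prod ν)) {θ : ℝ → ℝ} (hθ : AEStronglyMeasurable θ μ)
    {C : ℝ} (hC : ∀ᵐ x ∂μ, |θ x| ≤ C) :
    Integrable (Function.uncurry fun t x => v t x * θ t) (μ.prod ν) :=
  Integrable.mul_bdd (c := C) h hθ.comp_fst (Measure.quasiMeasurePreserving_fst.ae hC)

theorem Continuous.ae_abs_le_Ioo {ψ : ℝ → ℝ} (h : Continuous ψ) (a b : ℝ) :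
    ∃ C, ∀ᵐ x ∂(volume.restrict (Ioo a b)), |ψ x| ≤ C := by
  obtain ⟨C, hC⟩ := (isCompact_Icc (a := a) (b := b)).exists_bound_of_continuousOn h.continuousOn
  refine ⟨C, ?_⟩
  filter_upwards [ae_restrict_mem measurableSet_Ioo] with x hx
  exact hC x (Ioo_subset_Icc_self hx)

theorem eqOn_Icc_of_ae_eq_Ioo {l : ℝ} (hl : 0 < l) {f g : ℝ → ℝ}
    (h : ∀ᵐ x ∂(volume.restrict (Ioo 0 l)), f x = g x) (hf : ContinuousOn f (Icc 0 l))
    (hg : ContinuousOn g (Icc 0 l)) : EqOn f g (Icc 0 l) :=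
  Measure.eqOn_Icc_of_ae_eq volume hl.ne
    (by rw [← restrict_Ioo_eq_restrict_Icc]; exact h) hf hg

theorem continuousOn_slice {T l : ℝ} {η : ℝ → ℝ → ℝ}
    (hcont : ContinuousOn (Function.uncurry η) (Icc 0 T ×ˢ Icc 0 l)) {t : ℝ} (ht : t ∈ Icc 0 T) :
    ContinuousOn (η t) (Icc 0 l) :=
  hcont.comp (f := fun x => (t, x)) (by fun_prop) fun _ hx => ⟨ht, hx⟩

theorem continuousOn_integral_slice_mul {T l : ℝ} {η : ℝ → ℝ → ℝ}
    (hcont : ContinuousOn (Function.uncurry η) (Icc 0 T ×ˢ Icc 0 l)) {ζ : ℝ → ℝ}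
    (hζ : AEStronglyMeasurable ζ (volume.restrict (Ioo 0 l))) {C : ℝ}
    (hC : ∀ᵐ x ∂(volume.restrict (Ioo 0 l)), |ζ x| ≤ C) :
    ContinuousOn (fun t => ∫ x in Ioo 0 l, η t x * ζ x) (Icc 0 T) := by
  obtain ⟨K, hK⟩ := (isCompact_Icc.prod isCompact_Icc).exists_bound_of_continuousOn hcont
  refine continuousOn_of_dominated (bound := fun _ => K * C) ?_ ?_ (integrable_const _) ?_
  · intro t ht
    exact ((continuousOn_slice hcont ht).mono Ioo_subset_Icc_self).aestronglyMeasurable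
      measurableSet_Ioo |>.mul hζ
  · intro t ht
    filter_upwards [hC, ae_restrict_mem measurableSet_Ioo] with x hx hx'
    rw [norm_mul]
    have := hK (t, x) ⟨ht, Ioo_subset_Icc_self hx'⟩
    exact mul_le_mul this hx (norm_nonneg _) ((norm_nonneg _).trans this)
  · filter_upwards [ae_restrict_mem measurableSet_Ioo] with x hx
    refine ContinuousOn.mul ?_ continuousOn_const
    exact hcont.comp (f := fun t => (t, x)) (by fun_prop) fun t ht =>
      ⟨ht, Ioo_subset_Icc_self hx⟩

theorem integral_Ioo_sub {T : ℝ} {G : ℝ → ℝ} (hG : IntegrableOn G (Ioo 0 T)) {s t : ℝ}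
    (hs : s ∈ Icc 0 T) (ht : t ∈ Icc 0 T) :
    (∫ r in (0)..t, G r) - ∫ r in (0)..s, G r = ∫ r in s..t, G r := by
  have h0 : (0 : ℝ) ∈ Icc 0 T := ⟨le_rfl, hs.1.trans hs.2⟩
  exact intervalIntegral.integral_interval_sub_left
    (intervalIntegrable_of_integrableOn_Ioo hG h0 ht)
    (intervalIntegrable_of_integrableOn_Ioo hG h0 hs)

/-- The increments in time of `η`, tested against a bounded function of space. -/
theorem IsH1H1.integral_sub_mul {T l : ℝ} (hT : 0 < T) {η ηx ηt ηtx : ℝ → ℝ → ℝ}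
    (hη : IsH1H1 T l η ηx ηt ηtx)
    (hcont : ContinuousOn (Function.uncurry η) (Icc 0 T ×ˢ Icc 0 l)) {ζ : ℝ → ℝ}
    (hζ : AEStronglyMeasurable ζ (volume.restrict (Ioo 0 l))) {C : ℝ}
    (hC : ∀ᵐ x ∂(volume.restrict (Ioo 0 l)), |ζ x| ≤ C) {s t : ℝ} (hs : s ∈ Icc 0 T)
    (ht : t ∈ Icc 0 T) :
    ∫ x in Ioo 0 l, (η t x - η s x) * ζ x = ∫ r in s..t, ∫ x in Ioo 0 l, ηt r x * ζ x := by
  have i1 := hη.isL2H1.memLp.integrable_prod.mul_snd hζ hC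
  have i2 := hη.isL2H1_deriv.memLp.integrable_prod.mul_snd hζ hC
  have hG : IntegrableOn (fun t => ∫ x in Ioo 0 l, η t x * ζ x) (Ioo 0 T) := i1.integral_prod_left
  have hG' : IntegrableOn (fun t => ∫ x in Ioo 0 l, ηt t x * ζ x) (Ioo 0 T) := i2.integral_prod_left
  have hweak : ∀ θ, IsTestFun 0 T θ →
      ∫ t in Ioo 0 T, (∫ x in Ioo 0 l, η t x * ζ x) * deriv θ t
        = -∫ t in Ioo 0 T, (∫ x in Ioo 0 l, ηt t x * ζ x) * θ t := by
    intro θ hθ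
    obtain ⟨C1, hC1⟩ := hθ.1.continuous.ae_abs_le_Ioo 0 T
    obtain ⟨C2, hC2⟩ := hθ.deriv_continuous.ae_abs_le_Ioo 0 T
    simp_rw [← integral_mul_const]
    rw [integral_integral_swap (i1.mul_fst hθ.deriv_continuous.aestronglyMeasurable hC2),
      integral_integral_swap (i2.mul_fst hθ.1.continuous.aestronglyMeasurable hC1), ← integral_neg]
    apply integral_congr_ae
    filter_upwards [hη.weakDeriv θ hθ] with x hx
    have e1 : ∫ t in Ioo 0 T, η t x * ζ x * deriv θ t = ζ x * ∫ t in Ioo 0 T, η t x * deriv θ t := by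
      rw [← integral_const_mul]; congr 1; ext t; ring
    have e2 : ∫ t in Ioo 0 T, ηt t x * ζ x * θ t = ζ x * ∫ t in Ioo 0 T, ηt t x * θ t := by
      rw [← integral_const_mul]; congr 1; ext t; ring
    rw [e1, e2, hx]; ring
  -- Both functions are continuous in time, so equality almost everywhere becomes equality at every
  -- time, and s and t can be prescribed.
  have heq := eqOn_Icc_of_ae_eq_Ioo hT (ae_eq_contRep hT hG hG' hweak)
    (continuousOn_integral_slice_mul hcont hζ hC) (continuousOn_contRep hT _ hG')
  have hsl : ∀ r ∈ Icc 0 T, IntegrableOn (fun x => η r x * ζ x) (Ioo 0 l) := fun r hr =>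
    Integrable.mul_bdd (c := C)
      ((continuousOn_slice hcont hr).integrableOn_Icc.mono_set Ioo_subset_Icc_self) hζ hC
  rw [← integral_Ioo_sub hG' hs ht]
  have h1 := heq hs
  have h2 := heq ht
  simp only [contRep] at h1 h2
  simp_rw [sub_mul]
  rw [integral_sub (hsl t ht) (hsl s hs)]
  linarith

theorem intervalIntegral_swap {T l : ℝ} {B : ℝ → ℝ → ℝ}
    (hB : Integrable (Function.uncurry B)
      ((volume.restrict (Ioo 0 T)).prod (volume.restrict (Ioo 0 l))))
    {s t p q : ℝ} (hs : 0 ≤ s) (hst : s ≤ t) (ht : t ≤ T) (hp : 0 ≤ p) (hpq : p ≤ q) (hq : q ≤ l) :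
    ∫ r in s..t, ∫ z in p..q, B r z = ∫ z in p..q, ∫ r in s..t, B r z := by
  simp_rw [← setIntegral_Ioo_eq hst, ← setIntegral_Ioo_eq hpq]
  exact integral_integral_swap (hB.mono_Ioo hs ht hp hq)

theorem integrableOn_intervalIntegral {T l : ℝ} {B : ℝ → ℝ → ℝ}
    (hB : Integrable (Function.uncurry B)
      ((volume.restrict (Ioo 0 T)).prod (volume.restrict (Ioo 0 l))))
    {p q : ℝ} (hp : 0 ≤ p) (hpq : p ≤ q) (hq : q ≤ l) :
    IntegrableOn (fun r => ∫ z in p..q, B r z) (Ioo 0 T) := by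
  simp_rw [← setIntegral_Ioo_eq hpq]
  exact (hB.mono_Ioo le_rfl le_rfl hp hq).integral_prod_left

/-- Because `boundaryValue` is a space integral rather than a point evaluation, Fubini makes it
integrable in time. -/
theorem integrableOn_boundaryValue {T l : ℝ} {v vx : ℝ → ℝ → ℝ} (h : IsL2H1 T l v vx) :
    IntegrableOn (fun r => boundaryValue l (v r) (vx r)) (Ioo 0 T) := by
  obtain ⟨C, hC⟩ := (show Continuous fun y : ℝ => l - y by fun_prop).ae_abs_le_Ioo 0 l
  exact ((h.memLp.integrable_prod.sub (h.memLp_deriv.integrable_prod.mul_snd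
    (by fun_prop) hC)).integral_prod_left).const_mul _

/-- The fundamental theorem of calculus in time, at every point of space. -/
theorem IsH1H1.sub_eq_integral_contRep {T l : ℝ} (hT : 0 < T) (hl : 0 < l)
    {η ηx ηt ηtx : ℝ → ℝ → ℝ} (hη : IsH1H1 T l η ηx ηt ηtx)
    (hcont : ContinuousOn (Function.uncurry η) (Icc 0 T ×ˢ Icc 0 l)) {s t x : ℝ} (hs : 0 ≤ s)
    (hst : s ≤ t) (ht : t ≤ T) (hx : x ∈ Icc 0 l) :
    η t x - η s x = ∫ r in s..t, contRep l (ηt r) (ηtx r) x := by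
  have hs' : s ∈ Icc 0 T := ⟨hs, hst.trans ht⟩
  have ht' : t ∈ Icc 0 T := ⟨hs.trans hst, ht⟩
  have iB := hη.isL2H1_deriv.memLp_deriv.integrable_prod
  have iB' := iB.mono_Ioo hs ht le_rfl (le_refl l)
  have it' := hη.isL2H1_deriv.memLp.integrable_prod.mono_Ioo hs ht le_rfl (le_refl l)
  -- The increment g is continuous with weak derivative b, hence equals its representative at every
  -- x. By Fubini the linear formula `contRep` commutes with the time integral: `hA` treats the
  -- value at 0 and `intervalIntegral_swap` the primitive.
  set g := fun x => η t x - η s x with hg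
  set b := fun z => ∫ r in s..t, ηtx r z with hb
  have hgc : ContinuousOn g (Icc 0 l) :=
    (continuousOn_slice hcont ht').sub (continuousOn_slice hcont hs')
  have hbi : IntegrableOn b (Ioo 0 l) := by
    simp_rw [hb, ← setIntegral_Ioo_eq hst]
    exact iB'.integral_prod_right
  have hswap : ∀ ζ : ℝ → ℝ, Continuous ζ →
      ∫ r in s..t, ∫ x in Ioo 0 l, ηtx r x * ζ x = ∫ x in Ioo 0 l, b x * ζ x := by
    intro ζ hζ
    obtain ⟨C, hC⟩ := hζ.ae_abs_le_Ioo 0 l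
    rw [← setIntegral_Ioo_eq hst, integral_integral_swap (iB'.mul_snd hζ.aestronglyMeasurable hC)]
    congr 1
    ext x
    rw [integral_mul_const, hb, setIntegral_Ioo_eq hst]
  have hweak : ∀ ψ, IsTestFun 0 l ψ →
      ∫ x in Ioo 0 l, g x * deriv ψ x = -∫ x in Ioo 0 l, b x * ψ x := by
    intro ψ hψ
    obtain ⟨C, hC⟩ := hψ.deriv_continuous.ae_abs_le_Ioo 0 l
    rw [hη.integral_sub_mul hT hcont hψ.deriv_continuous.aestronglyMeasurable hC hs' ht',
      ← hswap ψ hψ.1.continuous, ← intervalIntegral.integral_neg, ← setIntegral_Ioo_eq hst,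
      ← setIntegral_Ioo_eq hst]
    apply integral_congr_ae
    filter_upwards [ae_restrict_of_ae_restrict_of_subset (Ioo_subset_Ioo hs ht)
      hη.isL2H1_deriv.slice] with r hr
    exact hr.weakDeriv ψ hψ
  have heq := eqOn_Icc_of_ae_eq_Ioo hl
    (ae_eq_contRep hl (hgc.integrableOn_Icc.mono_set Ioo_subset_Icc_self) hbi hweak) hgc
    (continuousOn_contRep hl _ hbi) hx
  have hlin : Continuous fun y : ℝ => l - y := by fun_prop
  have hA : boundaryValue l g b = ∫ r in s..t, boundaryValue l (ηt r) (ηtx r) := by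
    obtain ⟨C, hC⟩ := hlin.ae_abs_le_Ioo 0 l
    have h1 := hη.integral_sub_mul hT hcont (ζ := fun _ => 1) (by fun_prop) (C := 1) (by simp)
      hs' ht'
    simp only [mul_one] at h1
    have j1 : IntegrableOn (fun r => ∫ y in Ioo 0 l, ηt r y) (Ioo s t) := it'.integral_prod_left
    have j2 : IntegrableOn (fun r => ∫ y in Ioo 0 l, ηtx r y * (l - y)) (Ioo s t) :=
      (iB'.mul_snd hlin.aestronglyMeasurable hC).integral_prod_left
    simp only [boundaryValue]
    rw [intervalIntegral.integral_const_mul, integral_sub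
      (hgc.integrableOn_Icc.mono_set Ioo_subset_Icc_self) (integrable_mul_of_continuous hbi hlin),
      ← hswap _ hlin, h1, ← setIntegral_Ioo_eq hst, ← setIntegral_Ioo_eq hst,
      ← setIntegral_Ioo_eq hst, ← integral_sub j1 j2]
    congr 1
    apply integral_congr_ae
    filter_upwards [it'.prod_right_ae, iB'.prod_right_ae] with r h3 h4
    exact (integral_sub h3 (integrable_mul_of_continuous h4 hlin)).symm
  have iA := integrableOn_boundaryValue hη.isL2H1_deriv
  rw [show η t x - η s x = g x from rfl, heq]
  simp only [contRep]
  rw [intervalIntegral.integral_add (intervalIntegrable_of_integrableOn_Ioo iA hs' ht')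
    (intervalIntegrable_of_integrableOn_Ioo (integrableOn_intervalIntegral iB le_rfl hx.1 hx.2)
      hs' ht'), hA, intervalIntegral_swap iB hs hst ht le_rfl hx.1 hx.2]

/-! ### Vanishing of the velocity at contact points -/

theorem HasDerivAt.nonneg_of_forall_le_right {P : ℝ → ℝ} {m t T : ℝ} (h : HasDerivAt P m t)
    (htT : t < T) (hP : ∀ r, t < r → r ≤ T → P t ≤ P r) : 0 ≤ m := by
  have h1 := (hasDerivWithinAt_iff_tendsto_slope' (s := Ioi t) (by simp)).1 h.hasDerivWithinAt
  refine ge_of_tendsto h1 ?_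
  filter_upwards [Ioc_mem_nhdsGT htT] with r hr
  rw [slope_def_field]
  exact div_nonneg (sub_nonneg.2 (hP r hr.1 hr.2)) (sub_nonneg.2 hr.1.le)

theorem HasDerivAt.nonpos_of_forall_le_left {P : ℝ → ℝ} {m t T : ℝ} (h : HasDerivAt P m t)
    (htT : T < t) (hP : ∀ r, T ≤ r → r < t → P t ≤ P r) : m ≤ 0 := by
  have h1 := (hasDerivWithinAt_iff_tendsto_slope' (s := Iio t) (by simp)).1 h.hasDerivWithinAt
  refine le_of_tendsto h1 ?_
  filter_upwards [Ico_mem_nhdsLT htT] with r hr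
  rw [slope_def_field]
  exact div_nonpos_of_nonneg_of_nonpos (sub_nonneg.2 (hP r hr.1 hr.2)) (sub_nonpos.2 hr.2.le)

theorem continuousOn_primitive_Ioo {l : ℝ} (hl : 0 ≤ l) {g : ℝ → ℝ} (h : IntegrableOn g (Ioo 0 l)) :
    ContinuousOn (fun x => ∫ z in (0)..x, g z) (Icc 0 l) := by
  have h' : IntegrableOn g (uIcc 0 l) := by
    rw [uIcc_of_le hl]
    exact (integrableOn_Icc_iff_integrableOn_Ioo (μ := volume)).2 h
  rw [← uIcc_of_le hl]
  exact intervalIntegral.continuousOn_primitive_interval h'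

/-- The bound does not depend on x in [p, q]; this lets one pair of rationals serve all nearby
contact points. -/
theorem abs_integral_sub_le {l : ℝ} {g : ℝ → ℝ} (h : IntegrableOn g (Ioo 0 l)) {p x q : ℝ}
    (hp : 0 ≤ p) (hpx : p ≤ x) (hxq : x ≤ q) (hq : q ≤ l) :
    |(∫ z in (0)..x, g z) - ∫ z in (0)..p, g z| ≤ ∫ z in p..q, |g z| := by
  have hI : ∀ c ∈ Icc 0 l, ∀ d ∈ Icc 0 l, IntervalIntegrable g volume c d := fun c hc d hd =>
    intervalIntegrable_of_integrableOn_Ioo h hc hd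
  have h0 : (0 : ℝ) ∈ Icc 0 l := ⟨le_rfl, by linarith⟩
  have hpm : p ∈ Icc 0 l := ⟨hp, by linarith⟩
  have hxm : x ∈ Icc 0 l := ⟨by linarith, by linarith⟩
  have hqm : q ∈ Icc 0 l := ⟨by linarith, hq⟩
  rw [intervalIntegral.integral_interval_sub_left (hI _ h0 _ hxm) (hI _ h0 _ hpm)]
  refine (intervalIntegral.abs_integral_le_integral_abs hpx).trans ?_
  exact intervalIntegral.integral_mono_interval le_rfl hpx hxq
    (Eventually.of_forall fun _ => abs_nonneg _) (hI _ hpm _ hqm).abs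

/-- Rational intervals around `x` on which the integral of `|g|` is small. -/
theorem exists_rat_integral_abs_lt {l : ℝ} {g : ℝ → ℝ} (h : IntegrableOn g (Ioo 0 l)) {x : ℝ}
    (hx : x ∈ Ioo 0 l) {ε : ℝ} (hε : 0 < ε) :
    ∃ p q : ℚ, 0 ≤ (p : ℝ) ∧ (p : ℝ) ≤ x ∧ x ≤ q ∧ (q : ℝ) ≤ l ∧
      ∫ z in (p : ℝ)..q, |g z| < ε := by
  have hI : ∀ c ∈ Icc 0 l, ∀ d ∈ Icc 0 l, IntervalIntegrable (fun z => |g z|) volume c d :=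
    fun c hc d hd => (intervalIntegrable_of_integrableOn_Ioo h hc hd).abs
  have hc : ContinuousAt (fun x => ∫ z in (0)..x, |g z|) x :=
    (continuousOn_primitive_Ioo (hx.1.trans hx.2).le (show IntegrableOn (fun z => |g z|) (Ioo 0 l) volume from
      Integrable.abs h)).continuousAt (Icc_mem_nhds hx.1 hx.2)
  obtain ⟨δ, hδ, H⟩ := Metric.continuousAt_iff.1 hc (ε / 2) (by linarith)
  obtain ⟨p, hp1, hp2⟩ := exists_rat_btwn (show max 0 (x - δ) < x from
    max_lt hx.1 (by linarith))
  obtain ⟨q, hq1, hq2⟩ := exists_rat_btwn (show x < min l (x + δ) from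
    lt_min hx.2 (by linarith))
  have hp0 := (le_max_left _ _).trans_lt hp1
  have hpδ := (le_max_right _ _).trans_lt hp1
  have hql := hq2.trans_le (min_le_left _ _)
  have hqδ := hq2.trans_le (min_le_right _ _)
  refine ⟨p, q, hp0.le, hp2.le, hq1.le, hql.le, ?_⟩
  have h1 := H (x := (p : ℝ)) (by rw [Real.dist_eq, abs_lt]; constructor <;> linarith)
  have h2 := H (x := (q : ℝ)) (by rw [Real.dist_eq, abs_lt]; constructor <;> linarith)
  rw [Real.dist_eq, abs_lt] at h1 h2
  have h0 : (0 : ℝ) ∈ Icc 0 l := ⟨le_rfl, by linarith⟩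
  rw [← intervalIntegral.integral_interval_sub_left (hI _ h0 _ ⟨by linarith, hql.le⟩)
    (hI _ h0 _ ⟨hp0.le, by linarith⟩)]
  linarith [h1.1, h2.2]

theorem ae_hasDerivAt_Ioo {T : ℝ} (hT : 0 < T) {M : ℝ → ℝ} (hM : IntegrableOn M (Ioo 0 T)) :
    ∀ᵐ t ∂(volume.restrict (Ioo 0 T)), HasDerivAt (fun x => ∫ r in (0)..x, M r) (M t) t := by
  have := (intervalIntegrable_of_integrableOn_Ioo hM (left_mem_Icc.2 hT.le)
    (right_mem_Icc.2 hT.le)).ae_hasDerivAt_integral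
  rw [ae_restrict_iff' measurableSet_Ioo]
  filter_upwards [this] with t ht ht'
  rw [uIcc_of_le hT.le] at ht
  exact ht (Ioo_subset_Icc_self ht') 0 (left_mem_Icc.2 hT.le)

/-- At almost every time, the continuous representative of the velocity vanishes at every point of
contact. -/
theorem IsH1H1.ae_contRep_eq_zero {T l : ℝ} (hT : 0 < T) (hl : 0 < l)
    {η ηx ηt ηtx : ℝ → ℝ → ℝ} (hη : IsH1H1 T l η ηx ηt ηtx)
    (hcont : ContinuousOn (Function.uncurry η) (Icc 0 T ×ˢ Icc 0 l))
    (hnonneg : ∀ t ∈ Icc 0 T, ∀ x ∈ Icc 0 l, 0 ≤ η t x) :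
    ∀ᵐ t ∂(volume.restrict (Ioo 0 T)), ∀ x ∈ Ioo 0 l, η t x = 0 →
      contRep l (ηt t) (ηtx t) x = 0 := by
  have iB := hη.isL2H1_deriv.memLp_deriv.integrable_prod
  have iA := integrableOn_boundaryValue hη.isL2H1_deriv
  have iabs : Integrable (Function.uncurry fun r z => |ηtx r z|)
      ((volume.restrict (Ioo 0 T)).prod (volume.restrict (Ioo 0 l))) := iB.abs
  -- For x in [p, q] the representative of the velocity at x lies between L p q and U p q. These
  -- families are countable, so almost every t is a differentiation point of all of them
  -- simultaneously, with no reference to x.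
  set U : ℚ → ℚ → ℝ → ℝ := fun p q r =>
    boundaryValue l (ηt r) (ηtx r) + (∫ z in (0)..(p : ℝ), ηtx r z) + ∫ z in (p : ℝ)..q, |ηtx r z|
    with hU
  set L : ℚ → ℚ → ℝ → ℝ := fun p q r =>
    boundaryValue l (ηt r) (ηtx r) + (∫ z in (0)..(p : ℝ), ηtx r z) - ∫ z in (p : ℝ)..q, |ηtx r z|
    with hL
  have i1 : ∀ p q : ℚ, 0 ≤ (p : ℝ) → (p : ℝ) ≤ q → (q : ℝ) ≤ l →
      IntegrableOn (U p q) (Ioo 0 T) ∧ IntegrableOn (L p q) (Ioo 0 T) := fun p q hp hpq hq =>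
    ⟨(iA.add (integrableOn_intervalIntegral iB le_rfl hp (hpq.trans hq))).add
      (integrableOn_intervalIntegral iabs hp hpq hq),
     (iA.add (integrableOn_intervalIntegral iB le_rfl hp (hpq.trans hq))).sub
      (integrableOn_intervalIntegral iabs hp hpq hq)⟩
  have hder : ∀ᵐ t ∂(volume.restrict (Ioo 0 T)), ∀ p q : ℚ, 0 ≤ (p : ℝ) → (p : ℝ) ≤ q →
      (q : ℝ) ≤ l → HasDerivAt (fun x => ∫ r in (0)..x, U p q r) (U p q t) t ∧
        HasDerivAt (fun x => ∫ r in (0)..x, L p q r) (L p q t) t := by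
    rw [ae_all_iff]; intro p
    rw [ae_all_iff]; intro q
    by_cases h : 0 ≤ (p : ℝ) ∧ (p : ℝ) ≤ q ∧ (q : ℝ) ≤ l
    · filter_upwards [ae_hasDerivAt_Ioo hT (i1 p q h.1 h.2.1 h.2.2).1,
        ae_hasDerivAt_Ioo hT (i1 p q h.1 h.2.1 h.2.2).2] with t h1 h2 _ _ _
      exact ⟨h1, h2⟩
    · exact Eventually.of_forall fun t h1 h2 h3 => absurd ⟨h1, h2, h3⟩ h
  have hslice : ∀ᵐ r ∂(volume.restrict (Ioo 0 T)), IntegrableOn (ηtx r) (Ioo 0 l) :=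
    iB.prod_right_ae
  have hbound : ∀ r, IntegrableOn (ηtx r) (Ioo 0 l) → ∀ (p q : ℚ) (x : ℝ), 0 ≤ (p : ℝ) →
      (p : ℝ) ≤ x → x ≤ q → (q : ℝ) ≤ l → L p q r ≤ contRep l (ηt r) (ηtx r) x ∧
        contRep l (ηt r) (ηtx r) x ≤ U p q r := by
    intro r hr p q x hp hpx hxq hq
    have := abs_le.1 (abs_integral_sub_le hr hp hpx hxq hq)
    simp only [hU, hL, contRep]
    constructor <;> linarith [this.1, this.2]
  filter_upwards [hder, hslice, ae_restrict_mem measurableSet_Ioo] with t htd hti ht x hx hzero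
  have hxm := Ioo_subset_Icc_self hx
  have iV : IntegrableOn (fun r => contRep l (ηt r) (ηtx r) x) (Ioo 0 T) :=
    iA.add (integrableOn_intervalIntegral iB le_rfl hxm.1 hxm.2)
  have hmono : ∀ {F G : ℝ → ℝ} {s t : ℝ}, IntegrableOn F (Ioo 0 T) → IntegrableOn G (Ioo 0 T) →
      0 ≤ s → s ≤ t → t ≤ T → (∀ᵐ r ∂(volume.restrict (Ioo 0 T)), F r ≤ G r) →
      ∫ r in s..t, F r ≤ ∫ r in s..t, G r := by
    intro F G s t hF hG hs hst ht h
    rw [← setIntegral_Ioo_eq hst, ← setIntegral_Ioo_eq hst]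
    have hss : Ioo s t ⊆ Ioo 0 T := Ioo_subset_Ioo hs ht
    exact setIntegral_mono_ae_restrict (hF.mono_set hss) (hG.mono_set hss)
      (ae_restrict_of_ae_restrict_of_subset hss h)
  have htm := Ioo_subset_Icc_self ht
  apply le_antisymm
  · by_contra! hpos
    -- Half the value suffices: moving from x to p costs the integral of |ηtx| once, and L subtracts
    -- it once more, so L p q t > 0. On the other hand the integral of L over (r, t) is at most
    -- η(t,x) − η(r,x) = −η(r,x) ≤ 0, which forces L p q t ≤ 0.
    obtain ⟨p, q, hp, hpx, hxq, hq, hlt⟩ := exists_rat_integral_abs_lt hti hx (half_pos hpos)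
    have hLi := (i1 p q hp (hpx.trans hxq) hq).2
    have hle := (htd p q hp (hpx.trans hxq) hq).2.nonpos_of_forall_le_left ht.1 (fun r hr hrt => by
      have h1 := integral_Ioo_sub hLi ⟨hr, hrt.le.trans htm.2⟩ htm
      have h2 := hmono hLi iV hr hrt.le htm.2 (by
        filter_upwards [hslice] with r hr
        exact (hbound r hr p q x hp hpx hxq hq).1)
      rw [← hη.sub_eq_integral_contRep hT hl hcont hr hrt.le htm.2 hxm] at h2
      linarith [hnonneg r ⟨hr, hrt.le.trans htm.2⟩ x hxm])
    have := abs_le.1 (abs_integral_sub_le hti hp hpx hxq hq)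
    simp only [hL] at hle
    simp only [contRep] at hlt
    linarith [this.1, this.2]
  · by_contra! hneg
    obtain ⟨p, q, hp, hpx, hxq, hq, hlt⟩ := exists_rat_integral_abs_lt hti hx
      (half_pos (neg_pos.2 hneg))
    have hUi := (i1 p q hp (hpx.trans hxq) hq).1
    have hle := (htd p q hp (hpx.trans hxq) hq).1.nonneg_of_forall_le_right ht.2 (fun r hrt hr => by
      have h1 := integral_Ioo_sub hUi htm ⟨htm.1.trans hrt.le, hr⟩
      have h2 := hmono iV hUi htm.1 hrt.le hr (by
        filter_upwards [hslice] with r hr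
        exact (hbound r hr p q x hp hpx hxq hq).2)
      rw [← hη.sub_eq_integral_contRep hT hl hcont htm.1 hrt.le hr hxm] at h2
      linarith [hnonneg r ⟨htm.1.trans hrt.le, hr⟩ x hxm])
    have := abs_le.1 (abs_integral_sub_le hti hp hpx hxq hq)
    simp only [hU] at hle
    simp only [contRep] at hlt
    linarith [this.1, this.2]

theorem isClosed_contactSet {T l : ℝ} {η : ℝ → ℝ → ℝ}
    (hcont : ContinuousOn (Function.uncurry η) (Icc 0 T ×ˢ Icc 0 l)) :
    IsClosed (contactSet T l η) :=
  hcont.preimage_isClosed_of_isClosed (isClosed_Icc.prod isClosed_Icc) (isClosed_singleton (x := 0))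

/-- The velocity vanishes weakly along a graph in the contact set. -/
theorem IsH1H1.integral_graph {T l : ℝ} (hT : 0 < T) (hl : 0 < l) {η ηx ηt ηtx : ℝ → ℝ → ℝ}
    (hη : IsH1H1 T l η ηx ηt ηtx)
    (hcont : ContinuousOn (Function.uncurry η) (Icc 0 T ×ˢ Icc 0 l))
    (hnonneg : ∀ t ∈ Icc 0 T, ∀ x ∈ Icc 0 l, 0 ≤ η t x) {a b : ℝ} {f : ℝ → ℝ} (ha : 0 ≤ a)
    (hab : a ≤ b) (hb : b ≤ T) (hf : ∀ t ∈ Icc a b, f t ∈ Ioo 0 l)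
    (hcontact : ∀ t ∈ Icc a b, (t, f t) ∈ contactSet T l η) {φ φx : ℝ → ℝ → ℝ}
    (hφ : IsL2H10 T l φ φx) :
    ((∫ t in a..b, ∫ x in (f t)..l, ηtx t x * φ t x)
      = - ∫ t in a..b, ∫ x in (f t)..l, ηt t x * φx t x) ∧
    ((∫ t in a..b, ∫ x in (0)..(f t), ηtx t x * φ t x)
      = - ∫ t in a..b, ∫ x in (0)..(f t), ηt t x * φx t x) := by
  have hae : ∀ᵐ t ∂(volume.restrict (Ioo a b)),
      contRep l (ηt t) (ηtx t) (f t) = 0 ∧ f t ∈ Ioo 0 l ∧ IsH1 l (ηt t) (ηtx t) ∧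
        IsH10 l (φ t) (φx t) := by
    have hss : Ioo a b ⊆ Ioo 0 T := Ioo_subset_Ioo ha hb
    filter_upwards [ae_restrict_of_ae_restrict_of_subset hss
      (hη.ae_contRep_eq_zero hT hl hcont hnonneg), ae_restrict_of_ae_restrict_of_subset hss
      hη.isL2H1_deriv.slice, ae_restrict_of_ae_restrict_of_subset hss hφ.slice,
      ae_restrict_mem measurableSet_Ioo] with t h1 h2 h3 ht
    have htm := Ioo_subset_Icc_self ht
    exact ⟨h1 _ (hf t htm) (hcontact t htm).2, hf t htm, h2, h3⟩
  simp_rw [← setIntegral_Ioo_eq hab, ← integral_neg]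
  constructor
  · apply integral_congr_ae
    filter_upwards [hae] with t ⟨h1, h2, h3, h4⟩
    exact h3.integral_mul_isH10 hl h4 (Ioo_subset_Icc_self h2) (right_mem_Icc.2 hl.le) h2.2.le
      (Or.inr h1) (Or.inl rfl)
  · apply integral_congr_ae
    filter_upwards [hae] with t ⟨h1, h2, h3, h4⟩
    exact h3.integral_mul_isH10 hl h4 (left_mem_Icc.2 hl.le) (Ioo_subset_Icc_self h2) h2.1.le
      (Or.inl rfl) (Or.inr h1)

/-! ### The energy inequality for the positive part of the velocity -/

theorem derivWithin_half_sq {x : ℝ} (hx : 0 ≤ x) :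
    derivWithin (fun s : ℝ => s ^ 2 / 2) (Ici 0) x = x := by
  have h : HasDerivAt (fun s : ℝ => s ^ 2 / 2) x x := by
    have := (hasDerivAt_pow 2 x).div_const 2
    convert! this using 1
    simp
  exact h.hasDerivWithinAt.derivWithin (uniqueDiffOn_Ici (0 : ℝ) x hx)

theorem iteratedDerivWithin_two_half_sq {x : ℝ} (hx : 0 ≤ x) :
    iteratedDerivWithin 2 (fun s : ℝ => s ^ 2 / 2) (Ici 0) x = 1 := by
  rw [iteratedDerivWithin_succ, iteratedDerivWithin_one]
  refine (derivWithin_congr (f := fun s => s) (fun y hy => derivWithin_half_sq hy)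
    (derivWithin_half_sq hx)).trans ?_
  exact derivWithin_id _ _ (uniqueDiffOn_Ici (0 : ℝ) x hx)

theorem isRenormalizer_half_sq : IsRenormalizer (fun s => s ^ 2 / 2) where
  contDiffOn := by fun_prop
  zero := by simp
  deriv_zero := derivWithin_half_sq le_rfl
  growth := ⟨1, fun x hx => by
    rw [derivWithin_half_sq hx, iteratedDerivWithin_two_half_sq hx]
    norm_num⟩

/-- The weak derivative of the positive part. -/
theorem IsL2H1.posPart {T l : ℝ} (hl : 0 < l) {v vx : ℝ → ℝ → ℝ} (h : IsL2H1 T l v vx) :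
    IsL2H1 T l (fun t x => max (v t x) 0) (fun t => {x | 0 < v t x}.indicator (vx t)) := by
  refine ⟨?_, ?_, ?_⟩
  · refine h.memLp.mono
      (h.memLp.aestronglyMeasurable.aemeasurable.max aemeasurable_const).aestronglyMeasurable ?_
    refine Eventually.of_forall fun p => ?_
    simp only [Function.uncurry, Real.norm_eq_abs]
    rcases le_total (v p.1 p.2) 0 with h0 | h0 <;> simp [h0]
  · have he : Function.uncurry (fun t => {x | 0 < v t x}.indicator (vx t))
        = {p | 0 < Function.uncurry v p}.indicator (Function.uncurry vx) := by
      ext ⟨t, x⟩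
      by_cases h0 : 0 < v t x <;> simp [indicator, Function.uncurry, h0]
    rw [he]
    refine h.memLp_deriv.mono (h.memLp_deriv.aestronglyMeasurable.indicator₀
      (nullMeasurableSet_lt aemeasurable_const h.memLp.aestronglyMeasurable.aemeasurable)) ?_
    exact Eventually.of_forall fun x => norm_indicator_le_norm_self _ _
  · filter_upwards [h.slice] with t ht
    exact ht.posPart hl

/-- Nonnegative smooth cutoffs in time that decrease at unit rate over `(t₁, t₁ + δ)`. -/
theorem exists_time_cutoff {t₀ t₁ δ : ℝ} (h01 : t₀ < t₁) (hδ : 0 < δ) :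
    ∃ θ : ℝ → ℝ, ContDiff ℝ ∞ θ ∧ (∀ t, 0 ≤ θ t) ∧ (∀ t, t ≤ (t₀ + t₁) / 2 → θ t = 0) ∧
      (∀ t, t₁ + 2 * δ ≤ t → θ t = 0) ∧ (∀ t, t₁ < t → θ t ≤ 2) ∧
      (∀ t, t₁ < t → deriv θ t ≤ 0) ∧ (∀ t ∈ Ioo t₁ (t₁ + δ), deriv θ t = -(1 / δ)) := by
  obtain ⟨ρ, hρ, hρ0, hρ1, hρ2⟩ := exists_isTestFun_eq_one (a := -1) (b := 2) (a' := 0) (b' := 1)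
    (by norm_num) (by norm_num) (by norm_num)
  have hii : ∀ a b, IntervalIntegrable ρ volume a b := hρ.1.continuous.intervalIntegrable
  -- The tail integral of the bump ρ has slope −ρ, equal to −1 on [0, 1], and vanishes from 2 on.
  -- Composed with (t − t₁)/δ it descends within (t₁, t₁ + 2δ).
  set S : ℝ → ℝ := fun s => (∫ y in (0)..2, ρ y) - ∫ y in (0)..s, ρ y with hS
  have hSeq : ∀ s, S s = ∫ y in s..2, ρ y := fun s =>
    intervalIntegral.integral_interval_sub_left (hii _ _) (hii _ _)
  have hP := contDiff_infty_primitive hρ.1 0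
  have hSc : ContDiff ℝ ∞ S := contDiff_const.sub hP.1
  have hSd : ∀ s, HasDerivAt S (-ρ s) s := fun s => by
    have := (hP.1.differentiable (by simp) s).hasDerivAt
    rw [hP.2] at this
    exact this.const_sub _
  have hS2 : ∀ s, 2 ≤ s → S s = 0 := fun s hs => by
    rw [hSeq, intervalIntegral.integral_congr (g := fun _ => 0)]
    · simp
    · intro y hy
      rw [uIcc_of_ge hs] at hy
      exact hρ.eq_zero fun h => absurd h.2 (not_lt.2 hy.1)
  have hS0 : ∀ s, 0 ≤ S s := fun s => by
    rcases le_total s 2 with h | h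
    · rw [hSeq]; exact intervalIntegral.integral_nonneg h fun y _ => hρ0 y
    · rw [hS2 s h]
  have hSle : ∀ s, 0 ≤ s → S s ≤ 2 := fun s hs => by
    rcases le_total s 2 with h | h
    · rw [hSeq]
      have := intervalIntegral.integral_mono_on h (hii s 2)
        (intervalIntegrable_const (c := (1 : ℝ))) fun y _ => hρ1 y
      rw [intervalIntegral.integral_const, smul_eq_mul, mul_one] at this
      linarith
    · rw [hS2 s h]; norm_num
  set τ := (t₀ + t₁) / 2 with hτ
  have hτ1 : τ < t₁ := by rw [hτ]; linarith
  -- The switching on is completed by time t₁, inside the interval where the velocity is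
  -- nonpositive, so its slope will play no role.
  set κ : ℝ → ℝ := fun t => Real.smoothTransition ((t - τ) / (t₁ - τ)) with hκ
  have hκ1 : ∀ t, t₁ ≤ t → κ t = 1 := fun t ht =>
    Real.smoothTransition.one_of_one_le ((one_le_div (by linarith)).2 (by linarith))
  refine ⟨fun t => κ t * S ((t - t₁) / δ), ?_, ?_, ?_, ?_, ?_, ?_⟩
  · refine ContDiff.mul (Real.smoothTransition.contDiff.comp (by fun_prop)) (hSc.comp (by fun_prop))
  · exact fun t => mul_nonneg (Real.smoothTransition.nonneg _) (hS0 _)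
  · intro t ht
    have : κ t = 0 := Real.smoothTransition.zero_of_nonpos
      (div_nonpos_of_nonpos_of_nonneg (by linarith) (by linarith))
    simp [this]
  · intro t ht
    simp only
    rw [hS2 _ ((le_div_iff₀ hδ).2 (by linarith)), mul_zero]
  · intro t ht
    simp only
    rw [hκ1 t ht.le, one_mul]
    exact hSle _ (div_nonneg (by linarith) hδ.le)
  have hd : ∀ t, t₁ < t → deriv (fun t => κ t * S ((t - t₁) / δ)) t
      = -(ρ ((t - t₁) / δ) * (1 / δ)) := by
    intro t ht
    have h1 : HasDerivAt (fun t => S ((t - t₁) / δ)) (-ρ ((t - t₁) / δ) * (1 / δ)) t :=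
      (hSd _).comp t (((hasDerivAt_id t).sub_const t₁).div_const δ)
    have h2 : (fun t => κ t * S ((t - t₁) / δ)) =ᶠ[𝓝 t] fun t => S ((t - t₁) / δ) := by
      filter_upwards [Ioi_mem_nhds ht] with s hs
      rw [hκ1 s (le_of_lt hs), one_mul]
    rw [h2.deriv_eq, h1.deriv, neg_mul]
  constructor
  · intro t ht
    rw [hd t ht, neg_nonpos]
    exact mul_nonneg (hρ0 _) (by positivity)
  · intro t ht
    rw [hd t ht.1, hρ2, one_mul]
    exact ⟨div_nonneg (by linarith [ht.1]) hδ.le, (div_le_one hδ).2 (by linarith [ht.2])⟩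

theorem isSpaceTimeTestFun_mul {T l p q : ℝ} {θ χ : ℝ → ℝ} (hθ : ContDiff ℝ ∞ θ)
    (hqT : q < T) (hθ0 : ∀ t, t ∉ Icc p q → θ t = 0) (hχ : IsTestFun 0 l χ) :
    IsSpaceTimeTestFun T l (fun t x => θ t * χ x) := by
  have hz : ∀ z : ℝ × ℝ, z ∉ Icc p q ×ˢ tsupport χ →
      Function.uncurry (fun t x => θ t * χ x) z = 0 := by
    rintro ⟨t, x⟩ hz
    rw [mem_prod, not_and_or] at hz
    rcases hz with hz | hz
    · simp [Function.uncurry, hθ0 t hz]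
    · simp [Function.uncurry, image_eq_zero_of_notMem_tsupport hz]
  refine ⟨(hθ.comp contDiff_fst).mul (hχ.1.comp contDiff_snd),
    HasCompactSupport.intro (isCompact_Icc.prod hχ.2.1) hz, ?_⟩
  have : tsupport (Function.uncurry fun t x => θ t * χ x) ⊆ Icc p q ×ˢ tsupport χ :=
    closure_minimal (fun z hz' => by by_contra h; exact hz' (hz z h))
      (isClosed_Icc.prod (isClosed_tsupport χ))
  exact this.trans (prod_mono (fun t ht => lt_of_le_of_lt ht.2 hqT) hχ.2.2)

/-- The renormalized inequality with `b(s) = s² / 2` and a product test function. -/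
theorem RenormalizedInequality.energy {T l : ℝ} (hT : 0 < T) (hl : 0 < l) {ηx ηt ηtx : ℝ → ℝ → ℝ}
    {v₀ : ℝ → ℝ} (hR : RenormalizedInequality T l ηx ηt ηtx v₀) (ht : IsL2H1 T l ηt ηtx)
    {p q : ℝ} {θ χ : ℝ → ℝ} (hp : 0 < p) (hθ : ContDiff ℝ ∞ θ) (hθ0 : ∀ t, 0 ≤ θ t) (hqT : q < T)
    (hθz : ∀ t, t ∉ Icc p q → θ t = 0) (hχ : IsTestFun 0 l χ) (hχ0 : ∀ x, 0 ≤ χ x) :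
    -(∫ t in Ioo 0 T, ∫ x in Ioo 0 l, (max (ηt t x) 0) ^ 2 / 2 * (deriv θ t * χ x))
      ≤ |∫ t in Ioo 0 T, ∫ x in Ioo 0 l, ηtx t x * max (ηt t x) 0 * (θ t * deriv χ x)|
      + |∫ t in Ioo 0 T, ∫ x in Ioo 0 l, ({x | 0 < ηt t x}.indicator (ηtx t) x) ^ 2 * (θ t * χ x)|
      + |∫ t in Ioo 0 T, ∫ x in Ioo 0 l, ηx t x * max (ηt t x) 0 * (θ t * deriv χ x)|
      + |∫ t in Ioo 0 T, ∫ x in Ioo 0 l,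
          ηx t x * {x | 0 < ηt t x}.indicator (ηtx t) x * (θ t * χ x)| := by
  have hw := ht.posPart hl
  have hm : ∀ t x, (0 : ℝ) ≤ max (ηt t x) 0 := fun t x => le_max_right _ _
  -- Since b'(s) = s, the same weak derivative serves for both w and z.
  have h := hR _ isRenormalizer_half_sq _ (isSpaceTimeTestFun_mul hθ hqT hθz hχ)
    (fun t _ x _ => mul_nonneg (hθ0 t) (hχ0 x)) _ _ hw (by
      simp only [derivWithin_half_sq (hm _ _)]; exact hw)
  have hd1 : ∀ x t, deriv (fun s => θ s * χ x) t = deriv θ t * χ x := fun x t =>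
    deriv_mul_const (hθ.differentiable (by simp) t) _
  have hd2 : ∀ t x, deriv (fun x => θ t * χ x) x = θ t * deriv χ x := fun t x =>
    deriv_const_mul _ (hχ.1.differentiable (by simp) x)
  -- The cutoff vanishes at time 0, which removes the initial datum.
  have hθ00 : θ 0 = 0 := hθz 0 fun h => absurd h.1 (not_le.2 hp)
  simp only [derivWithin_half_sq (hm _ _), iteratedDerivWithin_two_half_sq (hm _ _), hd1, hd2,
    hθ00, zero_mul, mul_zero, mul_one, intervalIntegral.integral_zero, neg_zero] at h
  simp_rw [← setIntegral_Ioo_eq hT.le, ← setIntegral_Ioo_eq hl.le] at h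
  linarith [neg_abs_le (∫ t in Ioo 0 T, ∫ x in Ioo 0 l,
      ηtx t x * max (ηt t x) 0 * (θ t * deriv χ x)),
    neg_abs_le (∫ t in Ioo 0 T, ∫ x in Ioo 0 l,
      ({x | 0 < ηt t x}.indicator (ηtx t) x) ^ 2 * (θ t * χ x)),
    neg_abs_le (∫ t in Ioo 0 T, ∫ x in Ioo 0 l, ηx t x * max (ηt t x) 0 * (θ t * deriv χ x)),
    neg_abs_le (∫ t in Ioo 0 T, ∫ x in Ioo 0 l,
      ηx t x * {x | 0 < ηt t x}.indicator (ηtx t) x * (θ t * χ x))]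

/-- Only the majorant G has to be integrable; nothing is asked of H beyond the pointwise bound. -/
theorem abs_integral_integral_le {T l K : ℝ} {E : Set ℝ} (hE : MeasurableSet E) (hET : E ⊆ Ioo 0 T)
    {H G : ℝ → ℝ → ℝ}
    (hG : Integrable (Function.uncurry G)
      ((volume.restrict (Ioo 0 T)).prod (volume.restrict (Ioo 0 l))))
    (h : ∀ᵐ p ∂((volume.restrict (Ioo 0 T)).prod (volume.restrict (Ioo 0 l))),
      |H p.1 p.2| ≤ E.indicator (fun t => K * G t p.2) p.1) :
    |∫ t in Ioo 0 T, ∫ x in Ioo 0 l, H t x| ≤ K * ∫ t in E, ∫ x in Ioo 0 l, G t x := by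
  have hi : IntegrableOn (fun t => K * ∫ x in Ioo 0 l, G t x) (Ioo 0 T) :=
    hG.integral_prod_left.const_mul K
  have h1 : ∫ t in Ioo 0 T, E.indicator (fun t => K * ∫ x in Ioo 0 l, G t x) t
      = K * ∫ t in E, ∫ x in Ioo 0 l, G t x := by
    rw [setIntegral_indicator hE, inter_eq_right.2 hET, integral_const_mul]
  rw [← h1, ← Real.norm_eq_abs]
  simp_rw [← Real.norm_eq_abs] at h
  refine norm_integral_le_of_norm_le (hi.indicator hE) ?_
  filter_upwards [Measure.ae_ae_of_ae_prod h, hG.prod_right_ae] with t ht hGt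
  by_cases htE : t ∈ E
  · simp only [indicator_of_mem htE] at ht ⊢
    rw [← integral_const_mul]
    exact norm_integral_le_of_norm_le (hGt.const_mul K) ht
  · simp only [indicator_of_notMem htE] at ht ⊢
    have := norm_integral_le_of_norm_le (integrable_zero ℝ ℝ (volume.restrict (Ioo 0 l))) ht
    simpa using this

theorem IsTestFun.mono {a b a' b' : ℝ} {ψ : ℝ → ℝ} (h : IsTestFun a b ψ) (ha : a' ≤ a)
    (hb : b ≤ b') : IsTestFun a' b' ψ :=
  ⟨h.1, h.2.1, h.2.2.trans (Ioo_subset_Ioo ha hb)⟩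

theorem IsTestFun.deriv_eq_zero {a b : ℝ} {ψ : ℝ → ℝ} (h : IsTestFun a b ψ) {x : ℝ}
    (hx : x ∉ Ioo a b) : deriv ψ x = 0 := by
  by_contra h'
  exact hx (h.2.2 (support_deriv_subset h'))

theorem MeasureTheory.MemLp.integrable_prod_sq {T l : ℝ} {v : ℝ → ℝ → ℝ}
    (h : MemLp (Function.uncurry v) 2 (volume.restrict (Ioo 0 T ×ˢ Ioo 0 l))) :
    Integrable (Function.uncurry fun t x => v t x ^ 2)
      ((volume.restrict (Ioo 0 T)).prod (volume.restrict (Ioo 0 l))) := by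
  rw [← volume_restrict_prod]
  exact h.integrable_sq

/-- If the velocity is nonpositive before `t₁`, its positive part has small energy right
after `t₁`. -/
theorem RenormalizedInequality.exists_energy_bound {T l : ℝ} (hT : 0 < T) (hl : 0 < l)
    {ηx ηt ηtx : ℝ → ℝ → ℝ} {v₀ : ℝ → ℝ} (hR : RenormalizedInequality T l ηx ηt ηtx v₀)
    (ht : IsL2H1 T l ηt ηtx)
    (hx : MemLp (Function.uncurry ηx) 2 (volume.restrict (Ioo 0 T ×ˢ Ioo 0 l)))
    {t₀ t₁ x₀ x₁ : ℝ} (h0 : 0 < t₀) (h01 : t₀ < t₁) (hx0 : 0 < x₀) (hxl : x₁ < l)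
    (hle : ∀ᵐ p ∂(volume.restrict (Ioo t₀ t₁ ×ˢ Ioo x₀ x₁)), ηt p.1 p.2 ≤ 0)
    {χ : ℝ → ℝ} (hχ : IsTestFun x₀ x₁ χ) (hχ0 : ∀ x, 0 ≤ χ x) :
    ∃ (K : ℝ) (g : ℝ → ℝ), IntegrableOn g (Ioo 0 T) ∧ ∀ δ, 0 < δ → t₁ + 2 * δ < T →
      1 / δ * ∫ t in Ioo t₁ (t₁ + δ), ∫ x in Ioo 0 l, (max (ηt t x) 0) ^ 2 / 2 * χ x
        ≤ K * ∫ t in Ioo t₁ (t₁ + 2 * δ), g t := by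
  set μ := (volume.restrict (Ioo 0 T)).prod (volume.restrict (Ioo 0 l)) with hμ
  -- By |ab| ≤ a² + b² this single integrable function dominates all four integrands on the right of
  -- the energy inequality.
  set G : ℝ → ℝ → ℝ := fun t x => ηtx t x ^ 2 + ηt t x ^ 2 + ηx t x ^ 2 with hGdef
  have hG : Integrable (Function.uncurry G) μ :=
    (ht.memLp_deriv.integrable_prod_sq.add ht.memLp.integrable_prod_sq).add hx.integrable_prod_sq
  have hχl : IsTestFun 0 l χ := hχ.mono hx0.le hxl.le
  obtain ⟨C₁, hC₁⟩ := hχ.1.continuous.ae_abs_le_Ioo 0 l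
  obtain ⟨C₂, hC₂⟩ := hχ.deriv_continuous.ae_abs_le_Ioo 0 l
  have hZ : ∀ᵐ p ∂μ, p.1 ∈ Ioo t₀ t₁ → p.2 ∈ Ioo x₀ x₁ → ηt p.1 p.2 ≤ 0 := by
    rw [ae_restrict_iff' (measurableSet_Ioo.prod measurableSet_Ioo)] at hle
    rw [hμ, ← volume_restrict_prod]
    filter_upwards [ae_restrict_of_ae hle] with p hp h1 h2
    exact hp ⟨h1, h2⟩
  have hne : ∀ᵐ t ∂(volume.restrict (Ioo 0 T)), t ≠ t₁ :=
    ae_restrict_of_ae (by simp [ae_iff, measure_singleton])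
  -- All four terms have the form h · θξ with h = 0 where u ≤ 0. Before t₁ either θ = 0 or u ≤ 0 on
  -- the support of ξ; after t₁ + 2δ again θ = 0; in between θ ≤ 2.
  have hkey : ∀ (δ : ℝ), 0 < δ → t₁ + 2 * δ < T → ∀ θ : ℝ → ℝ, (∀ t, 0 ≤ θ t) →
      (∀ t, t ≤ (t₀ + t₁) / 2 → θ t = 0) → (∀ t, t₁ + 2 * δ ≤ t → θ t = 0) →
      (∀ t, t₁ < t → θ t ≤ 2) → ∀ (h : ℝ → ℝ → ℝ) (ξ : ℝ → ℝ) (C : ℝ),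
      (∀ᵐ x ∂(volume.restrict (Ioo 0 l)), |ξ x| ≤ C) → (∀ x, x ∉ Ioo x₀ x₁ → ξ x = 0) →
      (∀ t x, |h t x| ≤ G t x) → (∀ t x, ηt t x ≤ 0 → h t x = 0) →
      |∫ t in Ioo 0 T, ∫ x in Ioo 0 l, h t x * (θ t * ξ x)|
        ≤ 2 * C * ∫ t in Ioo t₁ (t₁ + 2 * δ), ∫ x in Ioo 0 l, G t x := by
    intro δ hδ hδT θ hθ0 hθz1 hθz2 hθ2 h ξ C hξ hξ0 hh hh0
    refine abs_integral_integral_le (H := fun t x => h t x * (θ t * ξ x)) measurableSet_Ioo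
      (Ioo_subset_Ioo (by linarith) hδT.le) hG ?_
    filter_upwards [hZ, Measure.quasiMeasurePreserving_fst.ae hne,
      Measure.quasiMeasurePreserving_snd.ae hξ] with p hp hp1 hp2
    have hGn : 0 ≤ G p.1 p.2 := (abs_nonneg _).trans (hh _ _)
    have hC : 0 ≤ C := (abs_nonneg _).trans hp2
    have hnn : 0 ≤ (Ioo t₁ (t₁ + 2 * δ)).indicator (fun t => 2 * C * G t p.2) p.1 := by
      by_cases hpE : p.1 ∈ Ioo t₁ (t₁ + 2 * δ)
      · rw [indicator_of_mem hpE]; positivity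
      · rw [indicator_of_notMem hpE]
    by_cases hpx : p.2 ∈ Ioo x₀ x₁
    · rcases lt_trichotomy p.1 t₁ with hlt | heq | hgt
      · rcases le_or_gt p.1 t₀ with h' | h'
        · rw [hθz1 _ (by linarith)]; simpa using hnn
        · rw [hh0 _ _ (hp ⟨h', hlt⟩ hpx)]; simpa using hnn
      · exact absurd heq hp1
      · rcases le_or_gt (t₁ + 2 * δ) p.1 with h' | h'
        · rw [hθz2 _ h']; simpa using hnn
        · rw [indicator_of_mem (show p.1 ∈ Ioo t₁ (t₁ + 2 * δ) from ⟨hgt, h'⟩), abs_mul, abs_mul,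
            abs_of_nonneg (hθ0 _), mul_comm]
          exact mul_le_mul (mul_le_mul (hθ2 _ hgt) hp2 (abs_nonneg _) (by norm_num)) (hh _ _)
            (abs_nonneg _) (by positivity)
    · rw [hξ0 _ hpx]; simpa using hnn
  set k : ℝ → ℝ := fun t => ∫ x in Ioo 0 l, (max (ηt t x) 0) ^ 2 / 2 * χ x with hk
  have hki : IntegrableOn k (Ioo 0 T) :=
    ((((ht.posPart hl).memLp.integrable_prod_sq).div_const 2).mul_snd (v := fun t x =>
      (max (ηt t x) 0) ^ 2 / 2) hχ.1.continuous.aestronglyMeasurable hC₁).integral_prod_left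
  have hk0 : ∀ t, 0 ≤ k t := fun t =>
    integral_nonneg fun x => mul_nonneg (by positivity) (hχ0 x)
  have hkz : ∀ᵐ t ∂(volume.restrict (Ioo 0 T)), t ∈ Ioo t₀ t₁ → k t = 0 := by
    filter_upwards [Measure.ae_ae_of_ae_prod hZ] with t h1 h2
    rw [hk]
    simp only
    rw [integral_congr_ae (g := fun _ => 0), integral_zero]
    filter_upwards [h1] with x hx'
    by_cases hxx : x ∈ Ioo x₀ x₁
    · rw [max_eq_right (hx' h2 hxx)]; simp
    · rw [hχ.eq_zero hxx]; simp
  -- Two terms carry χ and contribute 2C₁ each, two carry its derivative and contribute 2C₂ each.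
  -- Neither K nor g depends on δ.
  refine ⟨4 * C₁ + 4 * C₂, fun t => ∫ x in Ioo 0 l, G t x, hG.integral_prod_left, ?_⟩
  intro δ hδ hδT
  obtain ⟨θ, hθ, hθ0, hθz1, hθz2, hθ2, hθd, hθd'⟩ := exists_time_cutoff h01 hδ
  have hE := hR.energy hT hl ht (p := (t₀ + t₁) / 2) (q := t₁ + 2 * δ) (by linarith) hθ hθ0 hδT
    (fun t hnot => by
      by_cases h1 : t ≤ (t₀ + t₁) / 2
      · exact hθz1 t h1
      · exact hθz2 t (by
          by_contra h2
          exact hnot ⟨(not_le.1 h1).le, (not_le.1 h2).le⟩)) hχl hχ0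
  have key := hkey δ hδ hδT θ hθ0 hθz1 hθz2 hθ2
  have hχz : ∀ x, x ∉ Ioo x₀ x₁ → χ x = 0 := fun x hx' => hχ.eq_zero hx'
  have hχdz : ∀ x, x ∉ Ioo x₀ x₁ → deriv χ x = 0 := fun x hx' => hχ.deriv_eq_zero hx'
  have habs : ∀ a b c : ℝ, |a * b| ≤ a ^ 2 + b ^ 2 + c ^ 2 := fun a b c => by
    rw [abs_le]
    constructor <;> nlinarith [sq_nonneg (a + b), sq_nonneg (a - b), sq_nonneg c]
  have hpos : ∀ t x, (max (ηt t x) 0) ^ 2 ≤ ηt t x ^ 2 := fun t x => by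
    rcases le_total (ηt t x) 0 with h | h
    · rw [max_eq_right h]; nlinarith [sq_nonneg (ηt t x)]
    · rw [max_eq_left h]
  have hind : ∀ t x, ({x | 0 < ηt t x}.indicator (ηtx t) x) ^ 2 ≤ ηtx t x ^ 2 := fun t x => by
    by_cases h : 0 < ηt t x
    · rw [indicator_of_mem (show x ∈ {x | 0 < ηt t x} from h)]
    · rw [indicator_of_notMem (show x ∉ {x | 0 < ηt t x} from h)]; nlinarith [sq_nonneg (ηtx t x)]
  have hindz : ∀ t x, ηt t x ≤ 0 → {x | 0 < ηt t x}.indicator (ηtx t) x = 0 := fun t x h =>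
    indicator_of_notMem (show x ∉ {x | 0 < ηt t x} from not_lt.2 h) _
  have e1 := key (fun t x => ηtx t x * max (ηt t x) 0) (deriv χ) C₂ hC₂ hχdz
    (fun t x => (habs _ _ (ηx t x)).trans (by simp only [hGdef]; linarith [hpos t x]))
    (fun t x h => by rw [max_eq_right h, mul_zero])
  have e2 := key (fun t x => ({x | 0 < ηt t x}.indicator (ηtx t) x) ^ 2) χ C₁ hC₁ hχz
    (fun t x => by
      rw [abs_of_nonneg (sq_nonneg _)]
      simp only [hGdef]
      linarith [hind t x, sq_nonneg (ηt t x), sq_nonneg (ηx t x)])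
    (fun t x h => by rw [hindz t x h]; norm_num)
  have e3 := key (fun t x => ηx t x * max (ηt t x) 0) (deriv χ) C₂ hC₂ hχdz
    (fun t x => (habs _ _ (ηtx t x)).trans (by simp only [hGdef]; linarith [hpos t x]))
    (fun t x h => by rw [max_eq_right h, mul_zero])
  have e4 := key (fun t x => ηx t x * {x | 0 < ηt t x}.indicator (ηtx t) x) χ C₁ hC₁ hχz
    (fun t x => (habs _ _ (ηt t x)).trans (by simp only [hGdef]; linarith [hind t x]))
    (fun t x h => by rw [hindz t x h, mul_zero])
  obtain ⟨D, hD⟩ := (hθ.continuous_deriv (by simp)).ae_abs_le_Ioo 0 T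
  have hpull : ∫ t in Ioo 0 T, ∫ x in Ioo 0 l, (max (ηt t x) 0) ^ 2 / 2 * (deriv θ t * χ x)
      = ∫ t in Ioo 0 T, k t * deriv θ t := by
    congr 1
    ext t
    rw [hk, ← integral_mul_const]
    congr 1
    ext x
    ring
  have hsub : Ioo t₁ (t₁ + δ) ⊆ Ioo 0 T := Ioo_subset_Ioo (by linarith) (by linarith)
  -- The integrand −kθ' vanishes almost everywhere before t₁: θ' = 0 up to t₀ and k = 0 on (t₀, t₁).
  -- After t₁ it is nonnegative, and it equals k/δ on (t₁, t₁ + δ).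
  have hlow : 1 / δ * ∫ t in Ioo t₁ (t₁ + δ), k t ≤ -∫ t in Ioo 0 T, k t * deriv θ t := by
    have h1 : ∫ t in Ioo 0 T, (Ioo t₁ (t₁ + δ)).indicator (fun t => 1 / δ * k t) t
        = 1 / δ * ∫ t in Ioo t₁ (t₁ + δ), k t := by
      rw [setIntegral_indicator measurableSet_Ioo, inter_eq_right.2 hsub, integral_const_mul]
    rw [← h1, ← integral_neg]
    refine integral_mono_ae ((Integrable.const_mul hki _).indicator measurableSet_Ioo)
      (Integrable.mul_bdd hki (hθ.continuous_deriv (by simp)).aestronglyMeasurable hD).neg ?_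
    filter_upwards [hkz, hne] with t hz hn
    rcases lt_trichotomy t t₁ with hlt | heq | hgt
    · rw [indicator_of_notMem fun h => absurd h.1 (not_lt.2 hlt.le)]
      rcases le_or_gt t t₀ with h' | h'
      · have : deriv θ t = 0 := by
          have h2 : θ =ᶠ[𝓝 t] fun _ => 0 := by
            filter_upwards [Iio_mem_nhds (show t < (t₀ + t₁) / 2 by linarith)] with s hs
            exact hθz1 s (le_of_lt hs)
          rw [h2.deriv_eq]; simp
        rw [this]; simp
      · rw [hz ⟨h', hlt⟩]; simp
    · exact absurd heq hn
    · by_cases hm : t ∈ Ioo t₁ (t₁ + δ)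
      · rw [indicator_of_mem hm, hθd' t hm]
        apply le_of_eq; ring
      · rw [indicator_of_notMem hm]
        have := mul_nonneg (hk0 t) (neg_nonneg.2 (hθd t hgt))
        linarith
  rw [hpull] at hE
  calc _ ≤ _ := hlow
    _ ≤ _ := hE
    _ ≤ _ := add_le_add (add_le_add (add_le_add e1 e2) e3) e4
    _ = _ := by ring

/-! ### Weak convergence of the averages -/

theorem tendsto_setIntegral_Ioo_zero {T : ℝ} {g : ℝ → ℝ} (hg : IntegrableOn g (Ioo 0 T)) {t : ℝ}
    (ht : t ∈ Ioo 0 T) :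
    Tendsto (fun δ => ∫ r in Ioo t (t + 2 * δ), g r) (𝓝[>] 0) (𝓝 0) := by
  have hc : ContinuousAt (fun x => ∫ z in (0)..x, g z) t :=
    (continuousOn_primitive_Ioo (ht.1.trans ht.2).le hg).continuousAt (Icc_mem_nhds ht.1 ht.2)
  have h1 : Tendsto (fun δ : ℝ => t + 2 * δ) (𝓝[>] 0) (𝓝 t) := by
    have : Tendsto (fun δ : ℝ => t + 2 * δ) (𝓝 0) (𝓝 (t + 2 * 0)) :=
      (by fun_prop : Continuous fun δ : ℝ => t + 2 * δ).tendsto 0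
    rw [mul_zero, add_zero] at this
    exact this.mono_left nhdsWithin_le_nhds
  have h2 := (hc.tendsto.comp h1).sub_const (∫ z in (0)..t, g z)
  rw [sub_self] at h2
  refine h2.congr' ?_
  have hsmall : ∀ᶠ δ : ℝ in 𝓝[>] 0, t + 2 * δ < T := h1.eventually_lt_const ht.2
  filter_upwards [hsmall, self_mem_nhdsWithin] with δ hδ hδ0
  have hδ0' : (0 : ℝ) < δ := hδ0
  rw [setIntegral_Ioo_eq (by linarith)]
  exact integral_Ioo_sub hg (Ioo_subset_Icc_self ht) ⟨by linarith [ht.1], hδ.le⟩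

theorem abs_integral_mul_le {μ : Measure ℝ} {v d : ℝ → ℝ} {C ε : NNReal}
    (hv : AEStronglyMeasurable v μ) (hd : AEStronglyMeasurable d μ)
    (hC : eLpNorm v 2 μ ≤ C) (hε : eLpNorm d 2 μ ≤ ε) : |∫ x, v x * d x ∂μ| ≤ C * ε := by
  have h1 : ‖∫ x, v x * d x ∂μ‖ₑ ≤ (C * ε : NNReal) := by
    calc ‖∫ x, v x * d x ∂μ‖ₑ ≤ ∫⁻ x, ‖v x * d x‖ₑ ∂μ := enorm_integral_le_lintegral_enorm _
      _ = eLpNorm (v • d) 1 μ := by rw [eLpNorm_one_eq_lintegral_enorm]; rfl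
      _ ≤ eLpNorm v 2 μ * eLpNorm d 2 μ := eLpNorm_smul_le_mul_eLpNorm hd hv
      _ ≤ C * ε := by gcongr
      _ = (C * ε : NNReal) := by push_cast; rfl
  rw [enorm_le_coe] at h1
  exact_mod_cast h1

/-- Bounded functions supported away from the endpoints are dense in `L²`. -/
theorem exists_bounded_eLpNorm_sub_le {a b : ℝ} {φ : ℝ → ℝ}
    (hφ : MemLp φ 2 (volume.restrict (Ioo a b))) {ε : NNReal} (hε : 0 < ε) :
    ∃ (ζ : ℝ → ℝ) (M κ : ℝ), 0 ≤ M ∧ 0 < κ ∧ StronglyMeasurable ζ ∧ (∀ x, |ζ x| ≤ M) ∧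
      (∀ x, x ∉ Icc (a + κ) (b - κ) → ζ x = 0) ∧
      eLpNorm (fun x => φ x - ζ x) 2 (volume.restrict (Ioo a b)) ≤ ε := by
  set μ := volume.restrict (Ioo a b) with hμ
  set f := hφ.1.mk φ with hf
  have hfm : StronglyMeasurable f := hφ.1.stronglyMeasurable_mk
  have hfe : φ =ᵐ[μ] f := hφ.1.ae_eq_mk
  have hfL : MemLp f 2 μ := hφ.ae_eq hfe
  have hε2 : (0 : ℝ) < ε / 2 := by positivity
  obtain ⟨M, hM⟩ := hfL.eLpNorm_indicator_norm_ge_le hfm hε2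
  obtain ⟨δ, hδ, H⟩ := hfL.eLpNorm_indicator_le (by norm_num) (by norm_num) hε2
  -- The two edge strips of width κ have total measure at most δ, so by uniform integrability f
  -- restricted to them has norm at most ε/2. Truncation at height M costs the other ε/2.
  set κ := δ / 2 with hκ
  set A : Set ℝ := {x | M ≤ ‖f x‖₊} with hA
  set I : Set ℝ := Icc (a + κ) (b - κ) with hI
  have hAm : MeasurableSet A :=
    measurableSet_le measurable_const hfm.nnnorm.measurable.coe_nnreal_real
  have hIμ : μ Iᶜ ≤ ENNReal.ofReal δ := by
    rw [hμ, Measure.restrict_apply measurableSet_Icc.compl]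
    have hsub : Iᶜ ∩ Ioo a b ⊆ Ioo a (a + κ) ∪ Ioo (b - κ) b := by
      rintro x ⟨h1, h2⟩
      by_cases h : x < a + κ
      · exact Or.inl ⟨h2.1, h⟩
      · refine Or.inr ⟨?_, h2.2⟩
        by_contra h3
        exact h1 ⟨not_lt.1 h, not_lt.1 h3⟩
    calc _ ≤ _ := measure_mono hsub
      _ ≤ _ := measure_union_le _ _
      _ = _ := by
        rw [Real.volume_Ioo, Real.volume_Ioo, ← ENNReal.ofReal_add (by linarith) (by linarith)]
        congr 1
        rw [hκ]; ring
  refine ⟨(I \ A).indicator f, |M|, κ, abs_nonneg _, half_pos hδ,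
    hfm.indicator (measurableSet_Icc.diff hAm), ?_, ?_, ?_⟩
  · intro x
    by_cases hx : x ∈ I \ A
    · rw [indicator_of_mem hx]
      have : ¬ M ≤ ‖f x‖₊ := hx.2
      rw [not_le, coe_nnnorm, Real.norm_eq_abs] at this
      exact this.le.trans (le_abs_self M)
    · rw [indicator_of_notMem hx, abs_zero]; exact abs_nonneg _
  · exact fun x hx => indicator_of_notMem (fun h => hx h.1) _
  · have e : (fun x => φ x - (I \ A).indicator f x)
        =ᵐ[μ] A.indicator f + (Iᶜ \ A).indicator f := by
      filter_upwards [hfe] with x hx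
      rw [hx, Pi.add_apply]
      by_cases h1 : x ∈ A <;> by_cases h2 : x ∈ I <;> simp [indicator, h1, h2]
    rw [eLpNorm_congr_ae e]
    calc _ ≤ _ := eLpNorm_add_le (hfL.1.indicator hAm)
          (hfL.1.indicator (measurableSet_Icc.compl.diff hAm)) (by norm_num)
      _ ≤ ENNReal.ofReal (ε / 2) + ENNReal.ofReal (ε / 2) :=
        add_le_add hM (H _ (measurableSet_Icc.compl.diff hAm)
          ((measure_mono sdiff_subset).trans hIμ))
      _ = ε := by
        rw [← ENNReal.ofReal_add hε2.le hε2.le, add_halves, ENNReal.ofReal_coe_nnreal]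

/-- If the velocity is nonpositive before a contact time `t₁` on `(x₀, x₁)`, its averages right
after `t₁` converge weakly to zero there. -/
theorem RenormalizedInequality.tendsto_average_zero {T l : ℝ} (hT : 0 < T) (hl : 0 < l)
    {η ηx ηt ηtx : ℝ → ℝ → ℝ} (hη : IsH1H1 T l η ηx ηt ηtx)
    (hcont : ContinuousOn (Function.uncurry η) (Icc 0 T ×ˢ Icc 0 l))
    (hnonneg : ∀ t ∈ Icc 0 T, ∀ x ∈ Icc 0 l, 0 ≤ η t x) {v₀ : ℝ → ℝ}
    (hLt : IsLinftyL2 T l ηt) (hR : RenormalizedInequality T l ηx ηt ηtx v₀)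
    {t₀ t₁ x₀ x₁ : ℝ} (h0 : 0 < t₀) (h01 : t₀ < t₁) (h1T : t₁ < T) (hx0 : 0 < x₀) (hx01 : x₀ < x₁)
    (hxl : x₁ < l) (hz : ∀ x ∈ Icc x₀ x₁, η t₁ x = 0)
    (hle : ∀ᵐ p ∂(volume.restrict (Ioo t₀ t₁ ×ˢ Ioo x₀ x₁)), ηt p.1 p.2 ≤ 0)
    {φ : ℝ → ℝ} (hφ : MemLp φ 2 (volume.restrict (Ioo x₀ x₁))) :
    Tendsto (fun δ : ℝ => 1 / δ * ∫ t in t₁..(t₁ + δ), ∫ x in x₀..x₁, ηt t x * φ x)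
      (𝓝[>] 0) (𝓝 0) := by
  have ht₁ : t₁ ∈ Icc 0 T := ⟨by linarith, h1T.le⟩
  have hit := hη.isL2H1_deriv.memLp.integrable_prod
  have hsm : ∀ᶠ δ : ℝ in 𝓝[>] 0, 0 < δ ∧ t₁ + 2 * δ < T := by
    have : Tendsto (fun δ : ℝ => t₁ + 2 * δ) (𝓝 0) (𝓝 (t₁ + 2 * 0)) :=
      (by fun_prop : Continuous fun δ : ℝ => t₁ + 2 * δ).tendsto 0
    rw [mul_zero, add_zero] at this
    filter_upwards [self_mem_nhdsWithin,
      (this.mono_left nhdsWithin_le_nhds).eventually_lt_const h1T] with δ h1 h2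
    exact ⟨h1, h2⟩
  have hxsub : Ioo x₀ x₁ ⊆ Ioo 0 l := Ioo_subset_Ioo hx0.le hxl.le
  -- averages against smooth nonnegative cutoffs
  have hcut : ∀ χ : ℝ → ℝ, IsTestFun x₀ x₁ χ → (∀ x, 0 ≤ χ x) → (∀ x, χ x ≤ 1) →
      Tendsto (fun δ : ℝ => 1 / δ * ∫ t in t₁..(t₁ + δ), ∫ x in Ioo 0 l, ηt t x * χ x)
        (𝓝[>] 0) (𝓝 0) := by
    intro χ hχ hχ0 hχ1
    have hχC : ∀ᵐ x ∂(volume.restrict (Ioo 0 l)), |χ x| ≤ 1 :=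
      Eventually.of_forall fun x => by rw [abs_of_nonneg (hχ0 x)]; exact hχ1 x
    obtain ⟨K, g, hg, hKg⟩ := hR.exists_energy_bound hT hl hη.isL2H1_deriv
      hη.isL2H1.memLp_deriv h0 h01 hx0 hxl hle hχ hχ0
    have hlim : Tendsto (fun δ => K * ∫ r in Ioo t₁ (t₁ + 2 * δ), g r) (𝓝[>] 0) (𝓝 0) := by
      have := (tendsto_setIntegral_Ioo_zero hg (t := t₁) ⟨by linarith, h1T⟩).const_mul K
      rwa [mul_zero] at this
    have isq := (((hη.isL2H1_deriv.posPart hl).memLp.integrable_prod_sq).div_const 2).mul_snd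
      (v := fun t x => (max (ηt t x) 0) ^ 2 / 2) hχ.1.continuous.aestronglyMeasurable hχC
    have iχ := hit.mul_snd hχ.1.continuous.aestronglyMeasurable hχC
    rw [Metric.tendsto_nhds]
    intro ε hε
    -- In u ≤ α + (u⁺)²/(4α) the constant α integrates over (0, l) to ε/2. The energy average is
    -- below εα for small δ, which after division by 2α gives the other ε/2.
    set α := ε / (2 * l) with hα
    have hα0 : 0 < α := by positivity
    have hαl : α * l = ε / 2 := by rw [hα]; field_simp
    have hev := hlim.eventually_lt_const (show 0 < ε * α by positivity)
    filter_upwards [hsm, hev] with δ ⟨hδ, hδT⟩ hlt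
    have hδm : t₁ + δ ∈ Icc 0 T := ⟨by linarith, by linarith⟩
    have hle1 : t₁ ≤ t₁ + δ := by linarith
    -- The lower bound uses no energy: the integral is the increment of η from t₁, that is ∫η(t₁ +
    -- δ)χ.
    have hpos : 0 ≤ ∫ t in t₁..(t₁ + δ), ∫ x in Ioo 0 l, ηt t x * χ x := by
      rw [← hη.integral_sub_mul hT hcont hχ.1.continuous.aestronglyMeasurable hχC ht₁ hδm]
      refine setIntegral_nonneg measurableSet_Ioo fun x hx => ?_
      by_cases hxx : x ∈ Ioo x₀ x₁
      · rw [hz x (Ioo_subset_Icc_self hxx), sub_zero]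
        exact mul_nonneg (hnonneg _ hδm _ (Ioo_subset_Icc_self hx)) (hχ0 x)
      · rw [hχ.eq_zero hxx, mul_zero]
    have hsub : Ioo t₁ (t₁ + δ) ⊆ Ioo 0 T := Ioo_subset_Ioo ht₁.1 hδm.2
    have hup : ∫ t in t₁..(t₁ + δ), ∫ x in Ioo 0 l, ηt t x * χ x
        ≤ δ * (ε / 2) + 1 / (2 * α) *
          ∫ t in Ioo t₁ (t₁ + δ), ∫ x in Ioo 0 l, (max (ηt t x) 0) ^ 2 / 2 * χ x := by
      have hc : δ * (ε / 2) = ∫ t in Ioo t₁ (t₁ + δ), ε / 2 := by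
        rw [setIntegral_const, Real.volume_real_Ioo_of_le hle1, smul_eq_mul]; ring
      have isq' : IntegrableOn (fun t => ∫ x in Ioo 0 l, (max (ηt t x) 0) ^ 2 / 2 * χ x)
          (Ioo t₁ (t₁ + δ)) := IntegrableOn.mono_set isq.integral_prod_left hsub
      have iχ' : IntegrableOn (fun t => ∫ x in Ioo 0 l, ηt t x * χ x)
          (Ioo t₁ (t₁ + δ)) := IntegrableOn.mono_set iχ.integral_prod_left hsub
      rw [← setIntegral_Ioo_eq hle1, hc, ← integral_const_mul,
        ← integral_add (integrable_const _) (isq'.const_mul _)]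
      refine setIntegral_mono_ae_restrict iχ' ((integrable_const _).add (isq'.const_mul _)) ?_
      filter_upwards [ae_restrict_of_ae_restrict_of_subset hsub isq.prod_right_ae,
        ae_restrict_of_ae_restrict_of_subset hsub iχ.prod_right_ae] with t h1 h2
      have hcl : ε / 2 = ∫ x in Ioo 0 l, α := by
        rw [setIntegral_const, Real.volume_real_Ioo_of_le hl.le, smul_eq_mul, ← hαl]; ring
      simp only [Function.uncurry] at h1 h2
      rw [hcl, ← integral_const_mul, ← integral_add (integrable_const _) (h1.const_mul _)]
      refine integral_mono h2 ((integrable_const _).add (h1.const_mul _)) fun x => ?_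
      have hm : ηt t x ≤ max (ηt t x) 0 := le_max_left _ _
      set m := max (ηt t x) 0
      have hy : m ≤ α + 1 / (2 * α) * (m ^ 2 / 2) := by
        have : α + 1 / (2 * α) * (m ^ 2 / 2) - m = (m - 2 * α) ^ 2 / (4 * α) := by
          field_simp; ring
        have h4 : 0 ≤ (m - 2 * α) ^ 2 / (4 * α) := by positivity
        linarith
      calc ηt t x * χ x ≤ (α + 1 / (2 * α) * (m ^ 2 / 2)) * χ x :=
            mul_le_mul_of_nonneg_right (hm.trans hy) (hχ0 x)
        _ = α * χ x + 1 / (2 * α) * (m ^ 2 / 2 * χ x) := by ring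
        _ ≤ α + 1 / (2 * α) * (m ^ 2 / 2 * χ x) := by
            have := mul_le_mul_of_nonneg_left (hχ1 x) hα0.le
            linarith
    rw [Real.dist_eq, sub_zero, abs_of_nonneg (mul_nonneg (by positivity) hpos)]
    have hfin := mul_le_mul_of_nonneg_left hup (show 0 ≤ 1 / δ by positivity)
    have hK := (hKg δ hδ hδT).trans_lt hlt
    set Q := ∫ t in Ioo t₁ (t₁ + δ), ∫ x in Ioo 0 l, (max (ηt t x) 0) ^ 2 / 2 * χ x
    calc _ ≤ _ := hfin
      _ = ε / 2 + 1 / (2 * α) * (1 / δ * Q) := by field_simp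
      _ < ε / 2 + 1 / (2 * α) * (ε * α) := by gcongr
      _ = ε := by field_simp; norm_num
  obtain ⟨-, C, hC⟩ := hLt
  rw [Metric.tendsto_nhds]
  intro ε hε
  -- Dividing by C + 1 instead of C covers C = 0.
  obtain ⟨ε', hε', hCε⟩ : ∃ ε' : NNReal, 0 < ε' ∧ (C : ℝ) * ε' ≤ ε / 2 := by
    refine ⟨⟨ε / (2 * (C + 1)), by positivity⟩, ?_, ?_⟩
    · exact_mod_cast (show 0 < ε / (2 * ((C : ℝ) + 1)) by positivity)
    · show (C : ℝ) * (ε / (2 * (C + 1))) ≤ ε / 2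
      rw [mul_div_assoc', div_le_div_iff₀ (by positivity) (by norm_num)]
      nlinarith [C.2]
  obtain ⟨ζ, M, κ, hM, hκ, hζm, hζM, hζz, hζe⟩ := exists_bounded_eLpNorm_sub_le hφ hε'
  obtain ⟨χ, hχ, hχ0, hχ1, hχone⟩ := exists_isTestFun_eq_one (a' := x₀ + κ) (b' := x₁ - κ) hx01
    (by linarith) (by linarith)
  have hζχ : ∀ x, |ζ x| ≤ M * χ x := fun x => by
    by_cases hx : x ∈ Icc (x₀ + κ) (x₁ - κ)
    · rw [hχone x hx, mul_one]; exact hζM x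
    · rw [hζz x hx, abs_zero]; exact mul_nonneg hM (hχ0 x)
  have hχC : ∀ᵐ x ∂(volume.restrict (Ioo 0 l)), |χ x| ≤ 1 :=
    Eventually.of_forall fun x => by rw [abs_of_nonneg (hχ0 x)]; exact hχ1 x
  have hlim := (hcut χ hχ hχ0 hχ1).const_mul M
  rw [mul_zero] at hlim
  filter_upwards [hsm, hlim.eventually_lt_const (half_pos hε)] with δ ⟨hδ, hδT⟩ hlt
  have hδm : t₁ + δ ∈ Icc 0 T := ⟨by linarith, by linarith⟩
  have hle1 : t₁ ≤ t₁ + δ := by linarith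
  have hsub : Ioo t₁ (t₁ + δ) ⊆ Ioo 0 T := Ioo_subset_Ioo ht₁.1 hδm.2
  have hζout : ∀ x, x ∉ Ioo x₀ x₁ → ζ x = 0 := fun x hx => hζz x fun h =>
    hx ⟨by linarith [h.1], by linarith [h.2]⟩
  -- The velocity has no sign after t₁, so |ζ| ≤ Mχ cannot be used under the time integral. It can
  -- be used on the increment of η, which equals η(t₁ + δ) ≥ 0 on (x₀, x₁).
  have hb : |∫ t in t₁..(t₁ + δ), ∫ x in Ioo 0 l, ηt t x * ζ x|
      ≤ M * ∫ t in t₁..(t₁ + δ), ∫ x in Ioo 0 l, ηt t x * χ x := by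
    rw [← hη.integral_sub_mul hT hcont hζm.aestronglyMeasurable (Eventually.of_forall hζM) ht₁ hδm,
      ← hη.integral_sub_mul hT hcont hχ.1.continuous.aestronglyMeasurable hχC ht₁ hδm,
      ← integral_const_mul, ← Real.norm_eq_abs]
    have hci : IntegrableOn (fun x => η (t₁ + δ) x - η t₁ x) (Ioo 0 l) :=
      ((continuousOn_slice hcont hδm).sub (continuousOn_slice hcont ht₁)).integrableOn_Icc.mono_set
        Ioo_subset_Icc_self
    refine norm_integral_le_of_norm_le
      ((integrable_mul_of_continuous hci hχ.1.continuous).const_mul M) ?_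
    filter_upwards [ae_restrict_mem measurableSet_Ioo] with x hx
    by_cases hxx : x ∈ Ioo x₀ x₁
    · have hnn := hnonneg _ hδm _ (Ioo_subset_Icc_self hx)
      rw [hz x (Ioo_subset_Icc_self hxx), sub_zero, Real.norm_eq_abs, abs_mul, abs_of_nonneg hnn]
      calc η (t₁ + δ) x * |ζ x| ≤ η (t₁ + δ) x * (M * χ x) :=
            mul_le_mul_of_nonneg_left (hζχ x) hnn
        _ = _ := by ring
    · rw [hζout x hxx, hχ.eq_zero hxx]; simp
  have hζx : ∀ t, ∫ x in Ioo 0 l, ηt t x * ζ x = ∫ x in Ioo x₀ x₁, ηt t x * ζ x := fun t =>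
    setIntegral_eq_of_subset_of_forall_sdiff_eq_zero measurableSet_Ioo hxsub fun x hx => by
      rw [hζout x hx.2, mul_zero]
  -- The error of replacing φ by ζ is bounded for almost every single time, thanks to the L^∞ bound
  -- in time; integration over length δ then compensates the factor 1/δ.
  have hdiff : |∫ t in Ioo t₁ (t₁ + δ), ((∫ x in x₀..x₁, ηt t x * φ x)
      - ∫ x in Ioo 0 l, ηt t x * ζ x)| ≤ δ * (C * ε') := by
    have hae : ∀ᵐ t ∂(volume.restrict (Ioo t₁ (t₁ + δ))),
        ‖(∫ x in x₀..x₁, ηt t x * φ x) - ∫ x in Ioo 0 l, ηt t x * ζ x‖ ≤ C * ε' := by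
      filter_upwards [ae_restrict_of_ae_restrict_of_subset hsub hC,
        ae_restrict_of_ae_restrict_of_subset hsub hη.isL2H1_deriv.slice] with t h1 h2
      have hmono : volume.restrict (Ioo x₀ x₁) ≤ volume.restrict (Ioo 0 l) :=
        Measure.restrict_mono hxsub le_rfl
      have hv := h2.memLp.mono_measure hmono
      have hζ2 : MemLp ζ 2 (volume.restrict (Ioo x₀ x₁)) :=
        MemLp.of_bound hζm.aestronglyMeasurable M (Eventually.of_forall hζM)
      have e : (∫ x in Ioo x₀ x₁, ηt t x * φ x) - ∫ x in Ioo x₀ x₁, ηt t x * ζ x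
          = ∫ x in Ioo x₀ x₁, ηt t x * (φ x - ζ x) := by
        simp_rw [mul_sub]
        exact (integral_sub (hv.integrable_mul hφ) (hv.integrable_mul hζ2)).symm
      rw [hζx, ← setIntegral_Ioo_eq hx01.le, e]
      exact abs_integral_mul_le hv.1 (hφ.1.sub hζ2.1)
        ((eLpNorm_mono_measure _ hmono).trans h1) hζe
    have := norm_integral_le_of_norm_le (integrable_const ((C : ℝ) * ε')) hae
    rwa [setIntegral_const, Real.volume_real_Ioo_of_le hle1, smul_eq_mul,
      add_sub_cancel_left] at this
  have hφi : IntegrableOn (fun t => ∫ x in x₀..x₁, ηt t x * φ x) (Ioo t₁ (t₁ + δ)) := by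
    simp_rw [← setIntegral_Ioo_eq hx01.le]
    have hprod : MemLp (fun p : ℝ × ℝ => φ p.2) 2
        ((volume.restrict (Ioo t₁ (t₁ + δ))).prod (volume.restrict (Ioo x₀ x₁))) :=
      hφ.comp_snd _
    have hηt : MemLp (Function.uncurry ηt) 2
        ((volume.restrict (Ioo t₁ (t₁ + δ))).prod (volume.restrict (Ioo x₀ x₁))) := by
      rw [← volume_restrict_prod]
      exact hη.isL2H1_deriv.memLp.mono_measure
        (Measure.restrict_mono (prod_mono hsub hxsub) le_rfl)
    exact (hηt.integrable_mul hprod).integral_prod_left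
  have hζi : IntegrableOn (fun t => ∫ x in Ioo 0 l, ηt t x * ζ x) (Ioo t₁ (t₁ + δ)) :=
    IntegrableOn.mono_set (hit.mul_snd hζm.aestronglyMeasurable
      (Eventually.of_forall hζM)).integral_prod_left hsub
  rw [integral_sub hφi hζi, setIntegral_Ioo_eq hle1, setIntegral_Ioo_eq hle1] at hdiff
  set X := ∫ t in t₁..(t₁ + δ), ∫ x in x₀..x₁, ηt t x * φ x
  set Y := ∫ t in t₁..(t₁ + δ), ∫ x in Ioo 0 l, ηt t x * ζ x
  set Z := ∫ t in t₁..(t₁ + δ), ∫ x in Ioo 0 l, ηt t x * χ x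
  have hX : |X| ≤ δ * (C * ε') + M * Z := by
    have := abs_add_le (X - Y) Y
    rw [sub_add_cancel] at this
    linarith
  rw [Real.dist_eq, sub_zero, abs_mul, abs_of_nonneg (show 0 ≤ 1 / δ by positivity)]
  calc 1 / δ * |X| ≤ 1 / δ * (δ * (C * ε') + M * Z) := by gcongr
    _ = C * ε' + M * (1 / δ * Z) := by field_simp
    _ < ε := by linarith

/-- `η` is the continuous representative on `[0, T] × [0, l]` of its class. -/
theorem theorem2 (T l : ℝ) (hT : 0 < T) (hl : 0 < l) (η ηx ηt ηtx : ℝ → ℝ → ℝ)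
    (hη : IsH1H1 T l η ηx ηt ηtx)
    (hcont : ContinuousOn (Function.uncurry η) (Icc 0 T ×ˢ Icc 0 l))
    (hnonneg : ∀ t ∈ Icc 0 T, ∀ x ∈ Icc 0 l, 0 ≤ η t x) :
    (∀ (a b : ℝ) (f : ℝ → ℝ), 0 ≤ a → a ≤ b → b ≤ T →
      ContinuousOn f (Icc a b) → (MonotoneOn f (Icc a b) ∨ AntitoneOn f (Icc a b)) →
      (∀ t ∈ Icc a b, f t ∈ Ioo 0 l) →
      (∀ t ∈ Icc a b, (t, f t) ∈ frontier (contactSet T l η)) →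
      ∀ φ φx : ℝ → ℝ → ℝ, IsL2H10 T l φ φx →
        ((∫ t in a..b, ∫ x in (f t)..l, ηtx t x * φ t x)
          = - ∫ t in a..b, ∫ x in (f t)..l, ηt t x * φx t x) ∧
        ((∫ t in a..b, ∫ x in (0)..(f t), ηtx t x * φ t x)
          = - ∫ t in a..b, ∫ x in (0)..(f t), ηt t x * φx t x)) ∧
    (∀ v₀ : ℝ → ℝ, MemLp v₀ 2 (volume.restrict (Ioo 0 l)) →
      IsLinftyL2 T l η → IsLinftyL2 T l ηt →
      RenormalizedInequality T l ηx ηt ηtx v₀ →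
      ∀ t₀ t₁ x₀ x₁ : ℝ, 0 < t₀ → t₀ < t₁ → t₁ < T → 0 < x₀ → x₀ < x₁ → x₁ < l →
      (∀ x ∈ Icc x₀ x₁, η t₁ x = 0) →
      (∀ᵐ p ∂(volume.restrict (Ioo t₀ t₁ ×ˢ Ioo x₀ x₁)), ηt p.1 p.2 ≤ 0) →
      ∀ φ : ℝ → ℝ, MemLp φ 2 (volume.restrict (Ioo x₀ x₁)) →
        Tendsto (fun δ : ℝ => 1 / δ * ∫ t in t₁..(t₁ + δ), ∫ x in x₀..x₁, ηt t x * φ x)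
          (𝓝[>] 0) (𝓝 0)) := by
  refine ⟨fun a b f ha hab hb _ _ hf hfr φ φx hφ => ?_, fun v₀ _ _ hLt hR t₀ t₁ x₀ x₁ h0 h01 h1T hx0
    hx01 hxl hz hle φ hφ => ?_⟩
  · exact hη.integral_graph hT hl hcont hnonneg ha hab hb hf
      (fun t ht => (isClosed_contactSet hcont).frontier_subset (hfr t ht)) hφ
  · exact hR.tendsto_average_zero hT hl hη hcont hnonneg hLt h0 h01 h1T hx0 hx01 hxl hz hle hφ
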